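/- Let $s>0$. For real $\nu$ and $z>0$ let $J_\nu(z)=\sum_{k\ge 0}\frac{(-1)^k}{k!\,\Gamma(k+\nu+1)}(z/2)^{2k+\nu}$ be the Bessel function of the first kind, and for $x,y>0$ put $$\mathbb K^{Bessel}_{2,\nu}(x,y)=\frac{x^{1/2}J_{\nu+1}(x^{1/2})J_\nu(y^{1/2})-y^{1/2}J_{\nu+1}(y^{1/2})J_\nu(x^{1/2})}{2(x-y)},$$ extended to $x=y$ by continuity, i.e. $\mathbb K^{Bessel}_{2,\nu}(x,x)=\frac14\big(J_\nu(x^{1/2})^2-J_{\nu+1}(x^{1/2})J_{\nu-1}(x^{1/2})\big)$. For a scalar kernel $K$ on $(0,\infty)^2$ write $$M[K](x,y)=\begin{bmatrix}K(x,y)&\int_y^xK(x,t)\,dt\\ \frac{\partial}{\partial x}K(x,y)&K(y,x)\end{bmatrix}.$$ Let $$K^{Bessel}_s(x,y)=2\Big(\frac xy\Big)^{1/2}\mathbb K^{Bessel}_{2,2s-1}(4x,4y)-\frac{J_{2s-1}(2y^{1/2})}{2y^{1/2}}\int_0^{x^{1/2}}J_{2s-1}(2t)\,dt,\qquad \mathbb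 K^{Bessel}_{4,s}=M[K^{Bessel}_s].$$ For $a>-1$ let $L^a_n$ be the $n$-th Laguerre polynomial with parameter $a$, let $$K^{(L)}_{2N}(x,y)=(x^ae^{-x})^{1/2}(y^ae^{-y})^{1/2}\sum_{j=0}^{2N-1}\frac{j!}{\Gamma(j+a+1)}L^a_j(x)L^a_j(y)$$ be the corresponding Christoffel--Darboux kernel, and let $$\tilde S_4^{N,a}(x,y)=\frac12\Big(\frac xy\Big)^{1/2}K^{(L)}_{2N}(x,y)+\frac{(2N)!\,y^{(a-1)/2}e^{-y/2}L^a_{2N}(y)}{4\,\Gamma(a+2N)}\int_x^\infty t^{(a-1)/2}e^{-t/2}L^a_{2N-1}(t)\,dt .$$ The Laguerre symplectic ensemble with $N$ particles is represented by the scalar kernel $S_4^N(x,y)=2\tilde S_4^{N,2s-1}(2x,2y)$ and its matrix kernel $M[S_4^N]$; rescaled at the hard edge, the scalar kernel is $S^{(N)}(x,y)=\frac1{4N}S_4^N\big(\frac x{4N},\frac y{4N}\big)$. The scalar and matrix kernels of the hard edge scaling limit are, by definition, $K^{hard\ edge}_s(x,y)=\lim_{N\to\infty}S^{(N)}(x,y)$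 and $\mathbb K^{hard\ edge}_{4,s}=M[K^{hard\ edge}_s]$. Then for all $x,y>0$: 1. the limit $K^{hard\ edge}_s(x,y)=\lim_{N\to\infty}S^{(N)}(x,y)$ exists and equals $K^{Bessel}_s(x,y)$; 2. the function $t\mapsto J_{2s-1}(2t)$ is integrable on $[0,x^{1/2}]$, the function $t\mapsto K^{Bessel}_s(x,t)$ is integrable between $y$ and $x$, the function $u\mapsto K^{Bessel}_s(u,y)$ is differentiable at $x$, and $\mathbb K^{hard\ edge}_{4,s}(x,y)=\mathbb K^{Bessel}_{4,s}(x,y)$; moreover the rescaled matrix kernels $M[S^{(N)}](x,y)$ converge entrywise to $\mathbb K^{Bessel}_{4,s}(x,y)$ as $N\to\infty$; 3. this agrees with Forrester's formula: $$K^{Bessel}_s(x,y)=2\,\mathbb K^{Bessel}_{2,2s}(4x,4y)-\frac{J_{2s-1}(2y^{1/2})}{2y^{1/2}}\int_0^{x^{1/2}}J_{2s+1}(2t)\,dt.$$ -/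

import Mathlib

open Filter Topology MeasureTheory

namespace HardEdge

noncomputable section

/-- The Bessel function of the first kind `J_ν(z)` of real order `ν`, for `z > 0`:
`J_ν(z) = ∑_k (-1)^k / (k! Γ(k + ν + 1)) (z / 2)^(2k + ν)`.
Terms in which `k + ν + 1` is a pole of `Γ` vanish, as they should, since `Real.Gamma` takes
the value `0` at the poles and `0⁻¹ = 0`. -/
def besselJ (ν z : ℝ) : ℝ :=
  ∑' k : ℕ, (-1 : ℝ) ^ k / ((k.factorial : ℝ) * Real.Gamma ((k : ℝ) + ν + 1)) *
    (z / 2) ^ (2 * (k : ℝ) + ν)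

/-- The determinantal Bessel kernel of order `ν`,
`(√x J_{ν+1}(√x) J_ν(√y) - √y J_{ν+1}(√y) J_ν(√x)) / (2 (x - y))`,
extended to the diagonal by its limit `(J_ν(√x)² - J_{ν+1}(√x) J_{ν-1}(√x)) / 4`. -/
def besselKernel2 (ν x y : ℝ) : ℝ :=
  if x = y then
    (besselJ ν (√x) ^ 2 - besselJ (ν + 1) (√x) * besselJ (ν - 1) (√x)) / 4
  else
    (√x * besselJ (ν + 1) (√x) * besselJ ν (√y) -
      √y * besselJ (ν + 1) (√y) * besselJ ν (√x)) / (2 * (x - y))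

/-- The scalar kernel `K_s^{Bessel}(x, y)`. -/
def besselKernel (s x y : ℝ) : ℝ :=
  2 * √(x / y) * besselKernel2 (2 * s - 1) (4 * x) (4 * y) -
    besselJ (2 * s - 1) (2 * √y) / (2 * √y) *
      ∫ t in (0 : ℝ)..√x, besselJ (2 * s - 1) (2 * t)

/-- The `2 × 2` matrix kernel (for `β = 4`) built from a scalar kernel `K`. -/
def matrixKernel (K : ℝ → ℝ → ℝ) (x y : ℝ) : Matrix (Fin 2) (Fin 2) ℝ :=
  !![K x y, ∫ t in y..x, K x t;
     deriv (fun u => K u y) x, K y x]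

/-- The symplectic Bessel matrix kernel. -/
def besselKernel4 (s : ℝ) : ℝ → ℝ → Matrix (Fin 2) (Fin 2) ℝ :=
  matrixKernel (besselKernel s)

/-- The Laguerre polynomial `L_n^a(x)`, for `a > -1`:
`∑_{k ≤ n} (-1)^k binom(n + a, n - k) x^k / k!`. -/
def laguerre (n : ℕ) (a x : ℝ) : ℝ :=
  ∑ k ∈ Finset.range (n + 1),
    (-1 : ℝ) ^ k * (Real.Gamma ((n : ℝ) + a + 1) /
      (Real.Gamma ((k : ℝ) + a + 1) * ((n - k).factorial : ℝ))) * x ^ k / (k.factorial : ℝ)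

/-- The Christoffel-Darboux kernel of the first `M` Laguerre polynomials for the weight
`t^a e^{-t}` on `(0, ∞)`; the squared norm of `L_j^a` is `Γ(j + a + 1) / j!`. -/
def laguerreCD (M : ℕ) (a x y : ℝ) : ℝ :=
  √(x ^ a * Real.exp (-x)) * √(y ^ a * Real.exp (-y)) *
    ∑ j ∈ Finset.range M, (j.factorial : ℝ) / Real.Gamma ((j : ℝ) + a + 1) *
      laguerre j a x * laguerre j a y

/-- The kernel `S̃_4(x, y)` of the Laguerre symplectic ensemble of `N` particles, with
parameter `a`. -/
def laguerreS4tilde (N : ℕ) (a x y : ℝ) : ℝ :=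
  1 / 2 * √(x / y) * laguerreCD (2 * N) a x y +
    ((2 * N).factorial : ℝ) * y ^ ((a - 1) / 2) * Real.exp (-y / 2) * laguerre (2 * N) a y /
        (4 * Real.Gamma (a + 2 * (N : ℝ))) *
      ∫ t in Set.Ioi x, t ^ ((a - 1) / 2) * Real.exp (-t / 2) * laguerre (2 * N - 1) a t

/-- `S_4(x, y) = 2 S̃_4(2x, 2y)` with the parameter replaced by `2s - 1`. -/
def laguerreS4 (N : ℕ) (s x y : ℝ) : ℝ :=
  2 * laguerreS4tilde N (2 * s - 1) (2 * x) (2 * y)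

/-- The kernel of the Laguerre symplectic ensemble of `N` particles, rescaled at the hard
edge. -/
def scaledS4 (s : ℝ) (N : ℕ) (x y : ℝ) : ℝ :=
  1 / (4 * (N : ℝ)) * laguerreS4 N s (x / (4 * (N : ℝ))) (y / (4 * (N : ℝ)))

/-- The scalar kernel of the hard edge scaling limit (the limit exists for `x, y > 0`, which is
part of what the theorem asserts). -/
def hardEdgeKernel (s x y : ℝ) : ℝ :=
  limUnder atTop (fun N : ℕ => scaledS4 s N x y)

/-- The matrix kernel of the hard edge scaling limit. -/
def hardEdgeKernel4 (s : ℝ) : ℝ → ℝ → Matrix (Fin 2) (Fin 2) ℝ :=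
  matrixKernel (hardEdgeKernel s)

end

end HardEdge

/-!
# The symplectic Laguerre ensemble at the hard edge

All functions involved become entire after removing powers. Write
`Φ_ν(w) = ∑_k (-w)^k / (k! Γ(k + ν + 1))` for the Bessel–Clifford function, so that
`J_ν(2√x) = x^(ν/2) Φ_ν(x)`, and let `λ_n = n! / Γ(n + a + 1) · L_n^a` with `a = 2s - 1`. The
coefficient of `x^k` in `λ_n(x/M)` is that of `Φ_a` times a falling factorial divided by `M^k`;
for `n = M, M - 1` this factor lies in `[0, 1]` and tends to `1`, so `λ_n(x/M) → Φ_a(x)`, with all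
derivatives and locally uniformly, by dominated convergence of series.

The kernel is a sum over all degrees below `2N`, and the limit is reached through functions of the
two highest degrees only, thanks to the single relation
`2x λ_n' + (a + 1 - x) λ_n = (n + a + 1) λ_{n+1} - n λ_{n-1}` (`normLaguerre_derivative`).
* Integrating it along the scaling `(τx, τy)`, `0 ≤ τ ≤ 1`, and telescoping in `n` writes the
  Christoffel–Darboux kernel as `∫_0^1 τ^a (u(τx) v(τy) + v(τx) u(τy)) dτ` up to a constant, with
  `u, v` the Laguerre functions of degrees `2N` and `2N - 1` (`sum_laguerreFun_eq`). There is no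
  division by `x - y`, so the diagonal needs no separate treatment.
* Integrating it against `t^(s-1) e^(-t/2)` over `(0, ∞)` gives a two-step recursion by which the
  moments of odd degree vanish (`integral_rpow_mul_laguerreFun_eq_zero`). Hence the integral over
  `(x, ∞)` in the rank one term is minus the integral over `(0, x)`.

Thus the rescaled kernel equals `x^s y^(s-1)` times an expression in `u`, `v` that is smooth in each
variable (`scaledS4_eq`). The property `TendstoC1` (pointwise convergence with the first derivative,
under locally uniform bounds) is stable under the operations occurring in this expression, and it
yields the convergence of all four matrix entries. On the limit side the kernel
`besselKernel2` is the corresponding integral with `u = v = Φ_a` by Lommel's integrals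
(`besselKernel2_eq`), and the second form of the kernel follows from the three-term recurrence
(`besselKernel2_shift`) together with `J_{ν-1} - J_{ν+1} = 2 J_ν'` (`integral_besselJ_sub`).
-/

namespace HardEdge

/-! ### Weighted Bessel–Clifford series -/

/-- The reciprocal functional equation also holds at the poles of `Γ`, where `Γ⁻¹` takes the correct
value `0`. -/
theorem inv_Gamma_eq (z : ℝ) : (Real.Gamma z)⁻¹ = z * (Real.Gamma (z + 1))⁻¹ := by
  rcases eq_or_ne z 0 with rfl | hz
  · simp
  · rw [Real.Gamma_add_one hz, mul_inv, mul_inv_cancel_left₀ hz]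

/-- The coefficient `(-1)^k / (k! Γ(k + ν + 1))` of the Bessel–Clifford function of order `ν`. -/
noncomputable def cliffordCoeff (ν : ℝ) (k : ℕ) : ℝ :=
  (-1) ^ k / ((k.factorial : ℝ) * Real.Gamma ((k : ℝ) + ν + 1))

/-- The series `∑_k w_k (-x)^k / (k! Γ(k + ν + 1))`. The weight `w = 1` gives the Bessel–Clifford
function `x^(-ν/2) J_ν(2√x)`; weights with finite support give rescaled Laguerre polynomials. -/
noncomputable def cliffordSeries (w : ℕ → ℝ) (ν x : ℝ) : ℝ :=
  ∑' k : ℕ, w k * cliffordCoeff ν k * x ^ k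

/-- The Bessel–Clifford function of order `ν`, an entire function. -/
noncomputable def clifford (ν x : ℝ) : ℝ := cliffordSeries 1 ν x

theorem summable_cliffordCoeff (ν R : ℝ) :
    Summable (fun k : ℕ => |cliffordCoeff ν k| * |R| ^ k) := by
  refine summable_of_isBigO_nat (Real.summable_pow_div_factorial |R|) ?_
  refine Asymptotics.IsBigO.of_bound 1 ?_
  obtain ⟨K, hK⟩ := exists_nat_ge (1 - ν)
  filter_upwards [eventually_ge_atTop K] with k hk
  have h2 : (2 : ℝ) ≤ (k : ℝ) + ν + 1 := by
    have : (K : ℝ) ≤ k := by exact_mod_cast hk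
    linarith
  have hG : 1 ≤ Real.Gamma ((k : ℝ) + ν + 1) := by
    have := Real.Gamma_strictMonoOn_Ici.monotoneOn (Set.self_mem_Ici) h2 h2
    simpa using this
  have hf : (0 : ℝ) < k.factorial := by positivity
  rw [cliffordCoeff, Real.norm_of_nonneg (by positivity), Real.norm_of_nonneg (by positivity),
    abs_div, abs_pow, abs_neg, abs_one, one_pow, abs_of_pos (by positivity), one_mul,
    div_mul_eq_mul_div, one_mul]
  gcongr
  exact le_mul_of_one_le_right hf.le hG

theorem abs_cliffordSeries_term_le {w : ℕ → ℝ} (hw : ∀ k, |w k| ≤ 1) {ν x R : ℝ} (hx : |x| ≤ R)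
    (k : ℕ) : ‖w k * cliffordCoeff ν k * x ^ k‖ ≤ |cliffordCoeff ν k| * |R| ^ k := by
  rw [Real.norm_eq_abs, abs_mul, abs_mul, abs_pow]
  have : |w k| * |cliffordCoeff ν k| ≤ |cliffordCoeff ν k| :=
    mul_le_of_le_one_left (abs_nonneg _) (hw k)
  exact mul_le_mul this (pow_le_pow_left₀ (abs_nonneg _) (hx.trans (le_abs_self R)) k)
    (by positivity) (abs_nonneg _)

theorem summable_cliffordSeries {w : ℕ → ℝ} (hw : ∀ k, |w k| ≤ 1) (ν x : ℝ) :
    Summable (fun k : ℕ => w k * cliffordCoeff ν k * x ^ k) :=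
  Summable.of_norm_bounded (summable_cliffordCoeff ν |x|)
    (abs_cliffordSeries_term_le hw le_rfl)

theorem abs_cliffordSeries_le {w : ℕ → ℝ} (hw : ∀ k, |w k| ≤ 1) {ν x R : ℝ} (hx : |x| ≤ R) :
    |cliffordSeries w ν x| ≤ ∑' k : ℕ, |cliffordCoeff ν k| * |R| ^ k :=
  tsum_of_norm_bounded (summable_cliffordCoeff ν R).hasSum (abs_cliffordSeries_term_le hw hx)

theorem tendsto_cliffordSeries {w : ℕ → ℕ → ℝ} (hw : ∀ n k, |w n k| ≤ 1)
    (hlim : ∀ k, Tendsto (fun n => w n k) atTop (𝓝 1)) (ν x : ℝ) :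
    Tendsto (fun n => cliffordSeries (w n) ν x) atTop (𝓝 (clifford ν x)) := by
  refine tendsto_tsum_of_dominated_convergence (summable_cliffordCoeff ν |x|) (fun k => ?_)
    (Eventually.of_forall fun n k => abs_cliffordSeries_term_le (hw n) le_rfl k)
  simpa using ((hlim k).mul_const (cliffordCoeff ν k)).mul_const (x ^ k)

theorem succ_mul_cliffordCoeff_succ (ν : ℝ) (k : ℕ) :
    ((k : ℝ) + 1) * cliffordCoeff ν (k + 1) = -cliffordCoeff (ν + 1) k := by
  have h : ((k + 1 : ℕ) : ℝ) + ν + 1 = (k : ℝ) + (ν + 1) + 1 := by push_cast; ring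
  have hk : (k : ℝ) + 1 ≠ 0 := by positivity
  have hf : (k.factorial : ℝ) ≠ 0 := by positivity
  rw [cliffordCoeff, cliffordCoeff, h, Nat.factorial_succ, pow_succ]
  push_cast
  simp only [div_eq_mul_inv, mul_inv]
  field_simp

theorem hasDerivAt_cliffordSeries {w : ℕ → ℝ} (hw : ∀ k, |w k| ≤ 1) (ν x : ℝ) :
    HasDerivAt (cliffordSeries w ν) (-cliffordSeries (fun k => w (k + 1)) (ν + 1) x) x := by
  set R := |x| + 1 with hR
  have hxR : x ∈ Metric.ball (0 : ℝ) R := by simp [hR]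
  have hterm : ∀ (k : ℕ) (y : ℝ),
      w (k + 1) * cliffordCoeff ν (k + 1) * (((k + 1 : ℕ) : ℝ) * y ^ k)
        = -(w (k + 1) * cliffordCoeff (ν + 1) k * y ^ k) := by
    intro k y
    have := succ_mul_cliffordCoeff_succ ν k
    push_cast
    linear_combination (w (k + 1) * y ^ k) * this
  have key : HasDerivAt (fun z => ∑' k : ℕ, w (k + 1) * cliffordCoeff ν (k + 1) * z ^ (k + 1))
      (∑' k : ℕ, -(w (k + 1) * cliffordCoeff (ν + 1) k * x ^ k)) x := by
    refine hasDerivAt_tsum_of_isPreconnected (y₀ := x)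
      (g := fun k z => w (k + 1) * cliffordCoeff ν (k + 1) * z ^ (k + 1))
      (g' := fun k z => -(w (k + 1) * cliffordCoeff (ν + 1) k * z ^ k))
      (summable_cliffordCoeff (ν + 1) R)
      Metric.isOpen_ball (convex_ball (0 : ℝ) R).isPreconnected (fun k y _ => ?_)
      (fun k y hy => ?_) hxR ?_ hxR
    · rw [← hterm]
      exact (hasDerivAt_pow (k + 1) y).const_mul _
    · rw [norm_neg]
      exact abs_cliffordSeries_term_le (w := fun k => w (k + 1)) (fun k => hw (k + 1))
        (by simpa using (Metric.mem_ball.1 hy).le) k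
    · exact (summable_nat_add_iff 1).2 (summable_cliffordSeries hw ν x)
  have heq : cliffordSeries w ν = fun z =>
      w 0 * cliffordCoeff ν 0 + ∑' k : ℕ, w (k + 1) * cliffordCoeff ν (k + 1) * z ^ (k + 1) := by
    funext z
    rw [cliffordSeries, (summable_cliffordSeries hw ν z).tsum_eq_zero_add]
    simp
  rw [heq, cliffordSeries, ← tsum_neg]
  exact key.const_add _

theorem hasDerivAt_clifford (ν x : ℝ) :
    HasDerivAt (clifford ν) (-clifford (ν + 1) x) x :=
  hasDerivAt_cliffordSeries (w := 1) (by simp) ν x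

theorem continuous_clifford (ν : ℝ) : Continuous (clifford ν) :=
  continuous_iff_continuousAt.2 fun x => (hasDerivAt_clifford ν x).continuousAt

/-- The three-term recurrence; in terms of Bessel functions it is
`J_{ν-1}(z) + J_{ν+1}(z) = (2ν/z) J_ν(z)`. -/
theorem clifford_recurrence (ν x : ℝ) :
    clifford ν x = (ν + 1) * clifford (ν + 1) x - x * clifford (ν + 2) x := by
  have hs : ∀ μ, Summable (fun k : ℕ => cliffordCoeff μ k * x ^ k) := fun μ => by
    simpa using summable_cliffordSeries (w := 1) (by simp) μ x
  have he : ∀ μ, clifford μ x = ∑' k : ℕ, cliffordCoeff μ k * x ^ k := fun μ => by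
    simp [clifford, cliffordSeries]
  have h0 : cliffordCoeff ν 0 = (ν + 1) * cliffordCoeff (ν + 1) 0 := by
    have := inv_Gamma_eq (ν + 1)
    simpa [cliffordCoeff] using this
  have h1 : ∀ k, cliffordCoeff ν (k + 1) =
      (ν + 1) * cliffordCoeff (ν + 1) (k + 1) - cliffordCoeff (ν + 2) k := by
    intro k
    have hk : (k : ℝ) + 1 ≠ 0 := by positivity
    have e1 := succ_mul_cliffordCoeff_succ (ν + 1) k
    rw [show ν + 1 + 1 = ν + 2 by ring] at e1
    have e2 : cliffordCoeff ν (k + 1) = ((k : ℝ) + 1 + ν + 1) * cliffordCoeff (ν + 1) (k + 1) := by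
      have := inv_Gamma_eq ((k : ℝ) + 1 + ν + 1)
      simp only [cliffordCoeff, div_eq_mul_inv, mul_inv]
      push_cast
      rw [this, show (k : ℝ) + 1 + ν + 1 + 1 = (k : ℝ) + 1 + (ν + 1) + 1 by ring]
      ring
    rw [e2]
    linear_combination e1
  rw [he ν, he (ν + 1), he (ν + 2), (hs ν).tsum_eq_zero_add, (hs (ν + 1)).tsum_eq_zero_add,
    ← tsum_mul_left (a := x), mul_add, ← tsum_mul_left (a := ν + 1), add_sub_assoc,
    ← Summable.tsum_sub (((summable_nat_add_iff 1).2 (hs (ν + 1))).mul_left _)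
      ((hs (ν + 2)).mul_left x), h0]
  congr 1
  · ring
  · refine tsum_congr fun k => ?_
    rw [h1]
    ring

theorem besselJ_two_mul {t : ℝ} (ht : 0 < t) (ν : ℝ) :
    besselJ ν (2 * t) = t ^ ν * clifford ν (t ^ 2) := by
  rw [besselJ, clifford, cliffordSeries, ← tsum_mul_left]
  refine tsum_congr fun k => ?_
  rw [show 2 * t / 2 = t by ring, Real.rpow_add ht, cliffordCoeff,
    show (2 * (k : ℝ)) = ((2 * k : ℕ) : ℝ) by push_cast; ring, Real.rpow_natCast, pow_mul]
  simp only [Pi.one_apply]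
  ring

theorem besselJ_two_mul_sqrt {x : ℝ} (hx : 0 < x) (ν : ℝ) :
    besselJ ν (2 * √x) = x ^ (ν / 2) * clifford ν x := by
  rw [besselJ_two_mul (Real.sqrt_pos.2 hx), Real.sq_sqrt hx.le, Real.sqrt_eq_rpow,
    ← Real.rpow_mul hx.le]
  ring_nf

/-! ### Convergence together with the first derivative -/

/-- The sequence `f n` of differentiable functions converges pointwise to `g` together with its
first derivative, and both are bounded on every bounded set uniformly in `n`. -/
structure TendstoC1 (f : ℕ → ℝ → ℝ) (g : ℝ → ℝ) : Prop where
  differentiable : ∀ n, Differentiable ℝ (f n)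
  differentiable_lim : Differentiable ℝ g
  tendsto : ∀ x, Tendsto (fun n => f n x) atTop (𝓝 (g x))
  tendsto_deriv : ∀ x, Tendsto (fun n => deriv (f n) x) atTop (𝓝 (deriv g x))
  bound : ∀ R, ∃ C, ∀ n x, |x| ≤ R → |f n x| ≤ C
  bound_deriv : ∀ R, ∃ C, ∀ n x, |x| ≤ R → |deriv (f n) x| ≤ C

namespace TendstoC1

variable {f f' : ℕ → ℝ → ℝ} {g g' : ℝ → ℝ}

theorem bound_deriv_lim (h : TendstoC1 f g) (R : ℝ) :
    ∃ C, ∀ x, |x| ≤ R → |deriv g x| ≤ C := by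
  obtain ⟨C, hC⟩ := h.bound_deriv R
  exact ⟨C, fun x hx =>
    le_of_tendsto (h.tendsto_deriv x).abs (Eventually.of_forall fun n => hC n x hx)⟩

theorem const_seq {c : ℕ → ℝ} {l : ℝ} (hc : Tendsto c atTop (𝓝 l)) :
    TendstoC1 (fun n _ => c n) (fun _ => l) where
  differentiable _ := differentiable_const _
  differentiable_lim := differentiable_const _
  tendsto _ := hc
  tendsto_deriv _ := by simp
  bound _ := by
    obtain ⟨C, hC⟩ := hc.abs.bddAbove_range
    exact ⟨C, fun n _ _ => hC ⟨n, rfl⟩⟩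
  bound_deriv _ := ⟨0, by simp⟩

theorem const (c : ℝ) : TendstoC1 (fun _ _ => c) (fun _ => c) := const_seq tendsto_const_nhds

theorem mul (h : TendstoC1 f g) (h' : TendstoC1 f' g') :
    TendstoC1 (fun n x => f n x * f' n x) (fun x => g x * g' x) := by
  have hd : ∀ n x, deriv (fun x => f n x * f' n x) x
      = deriv (f n) x * f' n x + f n x * deriv (f' n) x := fun n x =>
    deriv_fun_mul (h.differentiable n x) (h'.differentiable n x)
  refine ⟨fun n => (h.differentiable n).mul (h'.differentiable n),
    h.differentiable_lim.mul h'.differentiable_lim, fun x => (h.tendsto x).mul (h'.tendsto x),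
    fun x => ?_, fun R => ?_, fun R => ?_⟩
  · simp only [hd]
    rw [deriv_fun_mul (h.differentiable_lim x) (h'.differentiable_lim x)]
    exact ((h.tendsto_deriv x).mul (h'.tendsto x)).add ((h.tendsto x).mul (h'.tendsto_deriv x))
  · obtain ⟨C, hC⟩ := h.bound R
    obtain ⟨C', hC'⟩ := h'.bound R
    refine ⟨C * C', fun n x hx => ?_⟩
    rw [abs_mul]
    exact mul_le_mul (hC n x hx) (hC' n x hx) (abs_nonneg _) ((abs_nonneg _).trans (hC n x hx))
  · obtain ⟨C, hC⟩ := h.bound R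
    obtain ⟨C', hC'⟩ := h'.bound R
    obtain ⟨D, hD⟩ := h.bound_deriv R
    obtain ⟨D', hD'⟩ := h'.bound_deriv R
    refine ⟨D * C' + C * D', fun n x hx => ?_⟩
    rw [hd]
    refine (abs_add_le _ _).trans (add_le_add ?_ ?_) <;> rw [abs_mul]
    · exact mul_le_mul (hD n x hx) (hC' n x hx) (abs_nonneg _) ((abs_nonneg _).trans (hD n x hx))
    · exact mul_le_mul (hC n x hx) (hD' n x hx) (abs_nonneg _) ((abs_nonneg _).trans (hC n x hx))

theorem add (h : TendstoC1 f g) (h' : TendstoC1 f' g') :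
    TendstoC1 (fun n x => f n x + f' n x) (fun x => g x + g' x) := by
  have hd : ∀ n x, deriv (fun x => f n x + f' n x) x = deriv (f n) x + deriv (f' n) x :=
    fun n x => deriv_fun_add (h.differentiable n x) (h'.differentiable n x)
  refine ⟨fun n => (h.differentiable n).add (h'.differentiable n),
    h.differentiable_lim.add h'.differentiable_lim, fun x => (h.tendsto x).add (h'.tendsto x),
    fun x => ?_, fun R => ?_, fun R => ?_⟩
  · simp only [hd]
    rw [deriv_fun_add (h.differentiable_lim x) (h'.differentiable_lim x)]
    exact (h.tendsto_deriv x).add (h'.tendsto_deriv x)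
  · obtain ⟨C, hC⟩ := h.bound R
    obtain ⟨C', hC'⟩ := h'.bound R
    exact ⟨C + C', fun n x hx =>
      (abs_add_le _ _).trans (add_le_add (hC n x hx) (hC' n x hx))⟩
  · obtain ⟨C, hC⟩ := h.bound_deriv R
    obtain ⟨C', hC'⟩ := h'.bound_deriv R
    refine ⟨C + C', fun n x hx => ?_⟩
    rw [hd]
    exact (abs_add_le _ _).trans (add_le_add (hC n x hx) (hC' n x hx))

/-- The derivative of a weighted series is minus the series of order `ν + 1` with shifted weights, so
the convergence of derivatives is the convergence of values at the next order. -/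
theorem cliffordSeries {w : ℕ → ℕ → ℝ} (hw : ∀ n k, |w n k| ≤ 1)
    (hlim : ∀ k, Tendsto (fun n => w n k) atTop (𝓝 1)) (ν : ℝ) :
    TendstoC1 (fun n => cliffordSeries (w n) ν) (clifford ν) := by
  have hd := fun n x => (hasDerivAt_cliffordSeries (hw n) ν x)
  refine ⟨fun n x => (hd n x).differentiableAt, fun x => (hasDerivAt_clifford ν x).differentiableAt,
    tendsto_cliffordSeries hw hlim ν, fun x => ?_, fun R => ?_, fun R => ?_⟩
  · simp only [(hd _ _).deriv, (hasDerivAt_clifford ν x).deriv]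
    exact (tendsto_cliffordSeries (w := fun n k => w n (k + 1)) (fun n k => hw n (k + 1))
      (fun k => hlim (k + 1)) (ν + 1) x).neg
  · exact ⟨_, fun n x hx => abs_cliffordSeries_le (hw n) hx⟩
  · refine ⟨∑' k : ℕ, |cliffordCoeff (ν + 1) k| * |R| ^ k, fun n x hx => ?_⟩
    rw [(hd n x).deriv, abs_neg]
    exact abs_cliffordSeries_le (fun k => hw n (k + 1)) hx

theorem exp_neg {c : ℕ → ℝ} (hc : Tendsto c atTop (𝓝 0)) :
    TendstoC1 (fun n x => Real.exp (-(c n * x))) (fun _ => 1) := by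
  have hd : ∀ n x, HasDerivAt (fun x => Real.exp (-(c n * x)))
      (Real.exp (-(c n * x)) * -c n) x := fun n x => by
    simpa using (((hasDerivAt_id x).const_mul (c n)).neg).exp
  have hlim : ∀ x, Tendsto (fun n => Real.exp (-(c n * x))) atTop (𝓝 1) := fun x => by
    simpa [Function.comp_def] using
      (Real.continuous_exp.tendsto _).comp ((hc.mul_const x).neg)
  obtain ⟨C, hC⟩ := hc.abs.bddAbove_range
  have hC' : ∀ n, |c n| ≤ C := fun n => hC ⟨n, rfl⟩
  have hb : ∀ R n x, |x| ≤ R → |Real.exp (-(c n * x))| ≤ Real.exp (C * R) := by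
    intro R n x hx
    rw [abs_of_pos (Real.exp_pos _)]
    refine Real.exp_le_exp.2 ((neg_le_abs _).trans ?_)
    rw [abs_mul]
    exact mul_le_mul (hC' n) hx (abs_nonneg _) ((abs_nonneg _).trans (hC' n))
  refine ⟨fun n x => (hd n x).differentiableAt, differentiable_const _, hlim, fun x => ?_,
    fun R => ⟨_, hb R⟩, fun R => ⟨Real.exp (C * R) * C, fun n x hx => ?_⟩⟩
  · simp only [(hd _ _).deriv]
    simpa using (hlim x).mul hc.neg
  · rw [(hd n x).deriv, abs_mul, abs_neg]
    exact mul_le_mul (hb R n x hx) (hC' n) (abs_nonneg _) (Real.exp_pos _).le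

end TendstoC1

/-! ### Integrals against a power on the unit interval -/

theorem aestronglyMeasurable_rpow_mul (b : ℝ) {h : ℝ → ℝ} (hh : Measurable h) (μ : Measure ℝ) :
    AEStronglyMeasurable (fun τ : ℝ => τ ^ b * h τ) μ :=
  ((measurable_id.pow_const b).mul hh).aestronglyMeasurable

theorem norm_rpow_mul_le {b C : ℝ} {h : ℝ → ℝ}
    (hC : ∀ τ ∈ Set.Icc (0 : ℝ) 1, |h τ| ≤ C) :
    ∀ τ ∈ Set.uIoc (0 : ℝ) 1, ‖τ ^ b * h τ‖ ≤ τ ^ b * C := by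
  intro τ hτ
  rw [Set.uIoc_of_le zero_le_one] at hτ
  rw [norm_mul, Real.norm_of_nonneg (Real.rpow_nonneg hτ.1.le b)]
  exact mul_le_mul_of_nonneg_left (hC τ ⟨hτ.1.le, hτ.2⟩) (Real.rpow_nonneg hτ.1.le b)

theorem intervalIntegrable_rpow_mul {b : ℝ} (hb : -1 < b) {C : ℝ} {h : ℝ → ℝ} (hh : Measurable h)
    (hC : ∀ τ ∈ Set.Icc (0 : ℝ) 1, |h τ| ≤ C) :
    IntervalIntegrable (fun τ : ℝ => τ ^ b * h τ) volume 0 1 := by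
  refine ((intervalIntegral.intervalIntegrable_rpow' hb).mul_const C).mono_fun'
    (aestronglyMeasurable_rpow_mul b hh _) ?_
  exact (ae_restrict_iff' measurableSet_uIoc).2 (Eventually.of_forall (norm_rpow_mul_le hC))

theorem abs_integral_rpow_mul_le {b : ℝ} (hb : -1 < b) {C : ℝ} {h : ℝ → ℝ}
    (hC : ∀ τ ∈ Set.Icc (0 : ℝ) 1, |h τ| ≤ C) :
    |∫ τ in (0 : ℝ)..1, τ ^ b * h τ| ≤ ∫ τ in (0 : ℝ)..1, τ ^ b * C := by
  rw [← Real.norm_eq_abs]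
  refine intervalIntegral.norm_integral_le_of_norm_le zero_le_one
    (Eventually.of_forall fun τ hτ => norm_rpow_mul_le hC τ ?_)
    ((intervalIntegral.intervalIntegrable_rpow' hb).mul_const C)
  rwa [Set.uIoc_of_le zero_le_one]

theorem tendsto_integral_rpow_mul {b : ℝ} (hb : -1 < b) {C : ℝ} {h : ℕ → ℝ → ℝ} {k : ℝ → ℝ}
    (hh : ∀ n, Measurable (h n)) (hC : ∀ n, ∀ τ ∈ Set.Icc (0 : ℝ) 1, |h n τ| ≤ C)
    (hlim : ∀ τ ∈ Set.Icc (0 : ℝ) 1, Tendsto (fun n => h n τ) atTop (𝓝 (k τ))) :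
    Tendsto (fun n => ∫ τ in (0 : ℝ)..1, τ ^ b * h n τ) atTop
      (𝓝 (∫ τ in (0 : ℝ)..1, τ ^ b * k τ)) := by
  refine intervalIntegral.tendsto_integral_filter_of_dominated_convergence (fun τ => τ ^ b * C)
    (Eventually.of_forall fun n => aestronglyMeasurable_rpow_mul b (hh n) _)
    (Eventually.of_forall fun n => Eventually.of_forall (norm_rpow_mul_le (hC n)))
    ((intervalIntegral.intervalIntegrable_rpow' hb).mul_const C)
    (Eventually.of_forall fun τ hτ => ?_)
  rw [Set.uIoc_of_le zero_le_one] at hτ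
  exact (hlim τ ⟨hτ.1.le, hτ.2⟩).const_mul _

/-- The integral `∫_0^1 τ^b f(τ x) g(τ y) dτ`, to which both the Christoffel–Darboux kernel and the
Bessel kernel reduce. -/
noncomputable def scaleIntegral (b : ℝ) (f g : ℝ → ℝ) (x y : ℝ) : ℝ :=
  ∫ τ in (0 : ℝ)..1, τ ^ b * (f (τ * x) * g (τ * y))

theorem scaleIntegral_comm (b : ℝ) (f g : ℝ → ℝ) (x y : ℝ) :
    scaleIntegral b f g x y = scaleIntegral b g f y x := by
  simp only [scaleIntegral, mul_comm]

theorem abs_mul_le_of_mem_Icc {τ x R : ℝ} (hτ : τ ∈ Set.Icc (0 : ℝ) 1) (hx : |x| ≤ R) :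
    |τ * x| ≤ R := by
  rw [abs_mul, abs_of_nonneg hτ.1]
  exact (mul_le_of_le_one_left (abs_nonneg x) hτ.2).trans hx

theorem exists_abs_le_of_continuous {g : ℝ → ℝ} (hg : Continuous g) (R : ℝ) :
    ∃ C, ∀ x, |x| ≤ R → |g x| ≤ C := by
  obtain ⟨C, hC⟩ := (isCompact_Icc (a := -R) (b := R)).exists_bound_of_continuousOn hg.continuousOn
  exact ⟨C, fun x hx => hC x (abs_le.1 hx)⟩

/-- Differentiation under the integral sign. -/
theorem hasDerivAt_scaleIntegral {b : ℝ} (hb : -1 < b) {f g : ℝ → ℝ} (hf : Differentiable ℝ f)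
    (hf' : ∀ R, ∃ C, ∀ x, |x| ≤ R → |deriv f x| ≤ C) (hg : Continuous g) (x y : ℝ) :
    HasDerivAt (fun x => scaleIntegral b f g x y)
      (∫ τ in (0 : ℝ)..1, τ ^ b * (τ * deriv f (τ * x) * g (τ * y))) x := by
  obtain ⟨C, hC⟩ := exists_abs_le_of_continuous hf.continuous |x|
  obtain ⟨D, hD⟩ := hf' (|x| + 1)
  obtain ⟨E, hE⟩ := exists_abs_le_of_continuous hg |y|
  have hm : ∀ z, Measurable fun τ => f (τ * z) * g (τ * y) := fun z =>
    ((hf.continuous.comp (continuous_mul_const z)).mul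
      (hg.comp (continuous_mul_const y))).measurable
  have hm' : Measurable fun τ => τ * deriv f (τ * x) * g (τ * y) :=
    (measurable_id.mul ((measurable_deriv f).comp (measurable_id.mul_const x))).mul
      (hg.comp (continuous_mul_const y)).measurable
  refine (intervalIntegral.hasDerivAt_integral_of_dominated_loc_of_deriv_le
    (F := fun x τ => τ ^ b * (f (τ * x) * g (τ * y)))
    (F' := fun x τ => τ ^ b * (τ * deriv f (τ * x) * g (τ * y)))
    (bound := fun τ => τ ^ b * (D * E)) (Metric.ball_mem_nhds x one_pos)
    (Eventually.of_forall fun z => aestronglyMeasurable_rpow_mul b (hm z) _)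
    (intervalIntegrable_rpow_mul hb (hm x) (C := C * E) fun τ hτ => ?_)
    (aestronglyMeasurable_rpow_mul b hm' _)
    (Eventually.of_forall fun τ hτ z hz => ?_)
    ((intervalIntegral.intervalIntegrable_rpow' hb).mul_const _)
    (Eventually.of_forall fun τ _ z _ => ?_)).2
  · rw [abs_mul]
    have h1 := hC _ (abs_mul_le_of_mem_Icc hτ le_rfl)
    exact mul_le_mul h1 (hE _ (abs_mul_le_of_mem_Icc hτ le_rfl)) (abs_nonneg _)
      ((abs_nonneg _).trans h1)
  · refine norm_rpow_mul_le (h := fun τ => τ * deriv f (τ * z) * g (τ * y))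
      (fun τ hτ => ?_) τ hτ
    have hz' : |z| ≤ |x| + 1 := by
      have h1 : |z - x| ≤ 1 := by simpa [Real.dist_eq] using (Metric.mem_ball.1 hz).le
      have h2 := abs_add_le x (z - x)
      rw [add_sub_cancel] at h2
      linarith
    have h1 := hD _ (abs_mul_le_of_mem_Icc hτ hz')
    have h2 := hE _ (abs_mul_le_of_mem_Icc hτ (le_refl |y|))
    rw [abs_mul]
    exact mul_le_mul (abs_mul_le_of_mem_Icc hτ h1) h2 (abs_nonneg _) ((abs_nonneg _).trans h1)
  · have h1 : HasDerivAt (fun x => f (τ * x)) (deriv f (τ * z) * τ) z := by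
      have h2 : HasDerivAt (fun x : ℝ => τ * x) τ z := by
        simpa using (hasDerivAt_id z).const_mul τ
      exact (hf (τ * z)).hasDerivAt.comp z h2
    have h3 := (h1.mul_const (g (τ * y))).const_mul (τ ^ b)
    rwa [mul_comm (deriv f (τ * z)) τ] at h3

theorem TendstoC1.scaleIntegral {f h : ℕ → ℝ → ℝ} {g k : ℝ → ℝ} (hf : TendstoC1 f g)
    (hh : TendstoC1 h k) {b : ℝ} (hb : -1 < b) (y : ℝ) :
    TendstoC1 (fun n x => scaleIntegral b (f n) (h n) x y) (fun x => scaleIntegral b g k x y) := by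
  have hd : ∀ n x, HasDerivAt (fun x => HardEdge.scaleIntegral b (f n) (h n) x y)
      (∫ τ in (0 : ℝ)..1, τ ^ b * (τ * deriv (f n) (τ * x) * h n (τ * y))) x := fun n x =>
    hasDerivAt_scaleIntegral hb (hf.differentiable n)
      (fun R => (hf.bound_deriv R).imp fun C hC => hC n) (hh.differentiable n).continuous x y
  have hd' : ∀ x, HasDerivAt (fun x => HardEdge.scaleIntegral b g k x y)
      (∫ τ in (0 : ℝ)..1, τ ^ b * (τ * deriv g (τ * x) * k (τ * y))) x := fun x =>
    hasDerivAt_scaleIntegral hb hf.differentiable_lim hf.bound_deriv_lim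
      hh.differentiable_lim.continuous x y
  obtain ⟨E, hE⟩ := hh.bound |y|
  have hb0 : ∀ R, ∃ C, ∀ n x, |x| ≤ R → ∀ τ ∈ Set.Icc (0 : ℝ) 1,
      |f n (τ * x) * h n (τ * y)| ≤ C := by
    intro R
    obtain ⟨C, hC⟩ := hf.bound R
    refine ⟨C * E, fun n x hx τ hτ => ?_⟩
    have h1 := hC n _ (abs_mul_le_of_mem_Icc hτ hx)
    rw [abs_mul]
    exact mul_le_mul h1 (hE n _ (abs_mul_le_of_mem_Icc hτ le_rfl)) (abs_nonneg _)
      ((abs_nonneg _).trans h1)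
  have hb1 : ∀ R, ∃ C, ∀ n x, |x| ≤ R → ∀ τ ∈ Set.Icc (0 : ℝ) 1,
      |τ * deriv (f n) (τ * x) * h n (τ * y)| ≤ C := by
    intro R
    obtain ⟨C, hC⟩ := hf.bound_deriv R
    refine ⟨C * E, fun n x hx τ hτ => ?_⟩
    have h1 := hC n _ (abs_mul_le_of_mem_Icc hτ hx)
    rw [abs_mul]
    exact mul_le_mul (abs_mul_le_of_mem_Icc hτ h1) (hE n _ (abs_mul_le_of_mem_Icc hτ le_rfl))
      (abs_nonneg _) ((abs_nonneg _).trans h1)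
  have hc : ∀ n, Measurable fun τ => h n (τ * y) := fun n =>
    ((hh.differentiable n).continuous.comp (continuous_mul_const y)).measurable
  refine ⟨fun n x => (hd n x).differentiableAt, fun x => (hd' x).differentiableAt, fun x => ?_,
    fun x => ?_, fun R => ?_, fun R => ?_⟩
  · obtain ⟨C, hC⟩ := hb0 |x|
    exact tendsto_integral_rpow_mul hb (fun n =>
      ((hf.differentiable n).continuous.comp (continuous_mul_const x)).measurable.mul (hc n))
      (fun n => hC n x le_rfl) (fun τ _ => (hf.tendsto _).mul (hh.tendsto _))
  · obtain ⟨C, hC⟩ := hb1 |x|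
    simp only [(hd _ _).deriv, (hd' _).deriv]
    exact tendsto_integral_rpow_mul hb (fun n => (measurable_id.mul
      ((measurable_deriv (f n)).comp (measurable_id.mul_const x))).mul (hc n))
      (fun n => hC n x le_rfl)
      (fun τ _ => ((hf.tendsto_deriv _).const_mul τ).mul (hh.tendsto _))
  · obtain ⟨C, hC⟩ := hb0 R
    exact ⟨_, fun n x hx => abs_integral_rpow_mul_le hb (hC n x hx)⟩
  · obtain ⟨C, hC⟩ := hb1 R
    refine ⟨∫ τ in (0 : ℝ)..1, τ ^ b * C, fun n x hx => ?_⟩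
    rw [(hd n x).deriv]
    exact abs_integral_rpow_mul_le hb (hC n x hx)

theorem intervalIntegrable_rpow_mul_continuous {b : ℝ} (hb : -1 < b) {h : ℝ → ℝ}
    (hh : Continuous h) : IntervalIntegrable (fun τ : ℝ => τ ^ b * h τ) volume 0 1 := by
  obtain ⟨C, hC⟩ := exists_abs_le_of_continuous hh 1
  exact intervalIntegrable_rpow_mul hb hh.measurable fun τ hτ =>
    hC τ (by rw [abs_of_nonneg hτ.1]; exact hτ.2)

theorem integral_rpow_mul_add {b : ℝ} (hb : -1 < b) {h k : ℝ → ℝ} (hh : Continuous h)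
    (hk : Continuous k) :
    ∫ τ in (0 : ℝ)..1, τ ^ b * (h τ + k τ) =
      (∫ τ in (0 : ℝ)..1, τ ^ b * h τ) + ∫ τ in (0 : ℝ)..1, τ ^ b * k τ := by
  rw [← intervalIntegral.integral_add (intervalIntegrable_rpow_mul_continuous hb hh)
    (intervalIntegrable_rpow_mul_continuous hb hk)]
  simp only [mul_add]

theorem integral_rpow_mul_const_mul (b c : ℝ) (h : ℝ → ℝ) :
    ∫ τ in (0 : ℝ)..1, τ ^ b * (c * h τ) = c * ∫ τ in (0 : ℝ)..1, τ ^ b * h τ := by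
  rw [← intervalIntegral.integral_const_mul]
  simp only [mul_left_comm]

theorem integral_rpow_mul_lincomb {b : ℝ} (hb : -1 < b) {f g h k : ℝ → ℝ} (hf : Continuous f)
    (hg : Continuous g) (hh : Continuous h) (hk : Continuous k) (c d : ℝ) :
    ∫ τ in (0 : ℝ)..1, τ ^ b * (c * (f τ + g τ) + d * (h τ + k τ)) =
      c * ((∫ τ in (0 : ℝ)..1, τ ^ b * f τ) + ∫ τ in (0 : ℝ)..1, τ ^ b * g τ) +
      d * ((∫ τ in (0 : ℝ)..1, τ ^ b * h τ) + ∫ τ in (0 : ℝ)..1, τ ^ b * k τ) := by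
  rw [integral_rpow_mul_add hb (h := fun τ => c * (f τ + g τ)) (k := fun τ => d * (h τ + k τ))
    ((hf.add hg).const_mul c) ((hh.add hk).const_mul d), integral_rpow_mul_const_mul b c,
    integral_rpow_mul_const_mul b d, integral_rpow_mul_add hb hf hg, integral_rpow_mul_add hb hh hk]

/-- The fundamental theorem of calculus for `τ^(b+1) h(τ)`, whose value at `0` vanishes. -/
theorem integral_rpow_mul_deriv {b : ℝ} (hb : -1 < b) {h h' : ℝ → ℝ}
    (hd : ∀ τ, HasDerivAt h (h' τ) τ) (hc : Continuous h') :
    ∫ τ in (0 : ℝ)..1, τ ^ b * ((b + 1) * h τ + τ * h' τ) = h 1 := by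
  have hcont : Continuous h := continuous_iff_continuousAt.2 fun τ => (hd τ).continuousAt
  have := intervalIntegral.integral_eq_sub_of_hasDerivAt_of_le (a := 0) (b := 1)
    (f := fun τ => τ ^ (b + 1) * h τ) (f' := fun τ => τ ^ b * ((b + 1) * h τ + τ * h' τ))
    zero_le_one ?_ (fun τ hτ => ?_)
    (intervalIntegrable_rpow_mul_continuous hb
      ((hcont.const_mul _).add (continuous_id.mul hc)))
  · rw [this, Real.one_rpow, Real.zero_rpow (by linarith)]
    ring
  · exact ((Real.continuous_rpow_const (by linarith)).mul hcont).continuousOn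
  · have h1 := (Real.hasDerivAt_rpow_const (p := b + 1) (Or.inl hτ.1.ne')).mul (hd τ)
    refine h1.congr_deriv ?_
    rw [add_sub_cancel_right, Real.rpow_add hτ.1, Real.rpow_one]
    ring

/-! ### Laguerre polynomials -/

open Polynomial in
/-- The Laguerre polynomial normalised to `n! / Γ(n + a + 1) · L_n^a`, that is
`∑_k binom(n, k) (-x)^k / Γ(k + a + 1)`. With this normalisation the polynomials at `x / n` converge
to the Bessel–Clifford function of order `a`. -/
noncomputable def normLaguerre (n : ℕ) (a : ℝ) : ℝ[X] :=
  ∑ k ∈ Finset.range (n + 1),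
    Polynomial.monomial k ((n.choose k : ℝ) * (-1) ^ k * (Real.Gamma ((k : ℝ) + a + 1))⁻¹)

theorem coeff_normLaguerre (n : ℕ) (a : ℝ) (k : ℕ) :
    (normLaguerre n a).coeff k =
      (n.choose k : ℝ) * (-1) ^ k * (Real.Gamma ((k : ℝ) + a + 1))⁻¹ := by
  rw [normLaguerre, Polynomial.finsetSum_coeff]
  simp only [Polynomial.coeff_monomial]
  rw [Finset.sum_ite_eq' (Finset.range (n + 1)) k]
  split_ifs with h
  · rfl
  · rw [Nat.choose_eq_zero_of_lt (by simpa using h)]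
    simp

theorem cast_choose_succ_mul (n k : ℕ) :
    (n.choose (k + 1) : ℝ) * (k + 1) = n.choose k * ((n : ℝ) - k) := by
  rcases le_or_gt k n with h | h
  · have := Nat.choose_succ_right_eq n k
    have h2 : ((n.choose (k + 1) * (k + 1) : ℕ) : ℝ) = ((n.choose k * (n - k) : ℕ) : ℝ) := by
      rw [this]
    push_cast [Nat.cast_sub h] at h2
    exact h2
  · rw [Nat.choose_eq_zero_of_lt h, Nat.choose_eq_zero_of_lt (by lia)]
    simp

theorem cast_mul_choose_pred (n k : ℕ) :
    (n : ℝ) * (n - 1).choose k = n.choose k * ((n : ℝ) - k) := by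
  rw [← cast_choose_succ_mul]
  cases n with
  | zero => simp
  | succ m =>
    have := Nat.add_one_mul_choose_eq m k
    exact_mod_cast this

open Polynomial in
/-- The sum of the derivative relation and the three-term recurrence of the Laguerre polynomials, in
which the terms in `n L_n` cancel. For `n = 0` the truncated index `n - 1` carries the
coefficient `0`. -/
theorem normLaguerre_derivative (n : ℕ) (a : ℝ) :
    2 * X * derivative (normLaguerre n a) + (C (a + 1) - X) * normLaguerre n a =
      C ((n : ℝ) + a + 1) * normLaguerre (n + 1) a - C (n : ℝ) * normLaguerre (n - 1) a := by
  ext k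
  rw [sub_mul, mul_assoc, show (2 : ℝ[X]) = C 2 from rfl]
  cases k with
  | zero =>
    simp [coeff_normLaguerre]
    ring
  | succ k =>
    have h1 := inv_Gamma_eq ((k : ℝ) + a + 1)
    have h2 := cast_choose_succ_mul n k
    have h3 := cast_mul_choose_pred n (k + 1)
    simp only [coeff_add, coeff_sub, coeff_C_mul, coeff_X_mul, coeff_derivative,
      coeff_normLaguerre, Nat.choose_succ_succ' n k]
    push_cast at h3 ⊢
    rw [h1, show (k : ℝ) + 1 + a + 1 = (k : ℝ) + a + 1 + 1 by ring, pow_succ]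
    linear_combination (-1) ^ k * (Real.Gamma ((k : ℝ) + a + 1 + 1))⁻¹ * (-h2 - h3)

theorem laguerre_eq (n : ℕ) (a x : ℝ) :
    laguerre n a x = Real.Gamma ((n : ℝ) + a + 1) / n.factorial * (normLaguerre n a).eval x := by
  rw [laguerre, normLaguerre, Polynomial.eval_finsetSum, Finset.mul_sum]
  refine Finset.sum_congr rfl fun k hk => ?_
  have hk' : k ≤ n := by simpa [Nat.lt_succ_iff] using hk
  have h1 : (n.factorial : ℝ) ≠ 0 := by positivity
  rw [Polynomial.eval_monomial, Nat.cast_choose ℝ hk']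
  simp only [div_eq_mul_inv, mul_inv]
  field_simp

theorem normLaguerre_eval_div (n M : ℕ) (a x : ℝ) :
    (normLaguerre n a).eval (x / M) =
      cliffordSeries (fun k => (n.descFactorial k : ℝ) / (M : ℝ) ^ k) a x := by
  rw [cliffordSeries, tsum_eq_sum (s := Finset.range (n + 1)), normLaguerre,
    Polynomial.eval_finsetSum]
  · refine Finset.sum_congr rfl fun k _ => ?_
    have h1 : (k.factorial : ℝ) ≠ 0 := by positivity
    rw [Polynomial.eval_monomial, Nat.descFactorial_eq_factorial_mul_choose, cliffordCoeff, div_pow]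
    push_cast
    simp only [div_eq_mul_inv, mul_inv]
    field_simp
  · intro k hk
    rw [Nat.descFactorial_eq_zero_iff_lt.2 (by simpa using hk)]
    simp

/-- The normalised Laguerre polynomial times `e^{-x/2}`. -/
noncomputable def laguerreFun (n : ℕ) (a x : ℝ) : ℝ :=
  Real.exp (-x / 2) * (normLaguerre n a).eval x

theorem contDiff_laguerreFun (n : ℕ) (a : ℝ) : ContDiff ℝ 1 (laguerreFun n a) :=
  ((contDiff_id.neg.div_const 2).exp).mul (Polynomial.contDiff_aeval (normLaguerre n a) 1)

theorem continuous_laguerreFun (n : ℕ) (a : ℝ) : Continuous (laguerreFun n a) :=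
  (contDiff_laguerreFun n a).continuous

theorem hasDerivAt_laguerreFun (n : ℕ) (a x : ℝ) :
    HasDerivAt (laguerreFun n a) (deriv (laguerreFun n a) x) x :=
  ((contDiff_laguerreFun n a).differentiable one_ne_zero x).hasDerivAt

theorem continuous_deriv_laguerreFun (n : ℕ) (a : ℝ) : Continuous (deriv (laguerreFun n a)) :=
  (contDiff_laguerreFun n a).continuous_deriv_one

theorem laguerreFun_deriv (n : ℕ) (a x : ℝ) :
    2 * x * deriv (laguerreFun n a) x + (a + 1) * laguerreFun n a x =
      ((n : ℝ) + a + 1) * laguerreFun (n + 1) a x - n * laguerreFun (n - 1) a x := by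
  have h1 : HasDerivAt (laguerreFun n a) (Real.exp (-x / 2) * (-1 / 2) *
      (normLaguerre n a).eval x +
      Real.exp (-x / 2) * (Polynomial.derivative (normLaguerre n a)).eval x) x :=
    (((hasDerivAt_id x).neg.div_const 2).exp).mul (Polynomial.hasDerivAt _ x)
  have h2 := congrArg (Polynomial.eval x) (normLaguerre_derivative n a)
  simp only [Polynomial.eval_add, Polynomial.eval_sub, Polynomial.eval_mul, Polynomial.eval_X,
    Polynomial.eval_C, Polynomial.eval_ofNat] at h2
  rw [h1.deriv]
  simp only [laguerreFun]
  linear_combination Real.exp (-x / 2) * h2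

theorem hasDerivAt_laguerreFun_mul (n : ℕ) (a x τ : ℝ) :
    HasDerivAt (fun τ => laguerreFun n a (τ * x)) (deriv (laguerreFun n a) (τ * x) * x) τ :=
  HasDerivAt.comp (h₂ := laguerreFun n a) τ (hasDerivAt_laguerreFun n a (τ * x))
    (hasDerivAt_mul_const x)

/-- The Christoffel–Darboux kernel as the integral over the scaling parameter of the two functions
of highest degree. -/
theorem sum_laguerreFun_eq {a : ℝ} (ha : -1 < a) (n : ℕ) (x y : ℝ) :
    ∑ j ∈ Finset.range n, Real.Gamma ((j : ℝ) + a + 1) / j.factorial *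
        (laguerreFun j a x * laguerreFun j a y) =
      n * Real.Gamma ((n : ℝ) + a + 1) / n.factorial / 2 *
        (scaleIntegral a (laguerreFun n a) (laguerreFun (n - 1) a) x y +
          scaleIntegral a (laguerreFun (n - 1) a) (laguerreFun n a) x y) := by
  induction n with
  | zero => simp
  | succ n ih =>
    have hc : ∀ i j, Continuous fun τ => laguerreFun i a (τ * x) * laguerreFun j a (τ * y) :=
      fun i j => ((continuous_laguerreFun i a).comp (continuous_mul_const x)).mul
        ((continuous_laguerreFun j a).comp (continuous_mul_const y))
    have hcd : Continuous fun τ => deriv (laguerreFun n a) (τ * x) * x * laguerreFun n a (τ * y) +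
        laguerreFun n a (τ * x) * (deriv (laguerreFun n a) (τ * y) * y) := by
      have h1 := continuous_laguerreFun n a
      have h2 := continuous_deriv_laguerreFun n a
      fun_prop
    have key := integral_rpow_mul_deriv ha
      (h := fun τ => laguerreFun n a (τ * x) * laguerreFun n a (τ * y)) (fun τ =>
        (hasDerivAt_laguerreFun_mul n a x τ).fun_mul (hasDerivAt_laguerreFun_mul n a y τ)) hcd
    have hint : ∀ τ : ℝ, τ ^ a * ((a + 1) * (laguerreFun n a (τ * x) * laguerreFun n a (τ * y)) +
        τ * (deriv (laguerreFun n a) (τ * x) * x * laguerreFun n a (τ * y) +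
          laguerreFun n a (τ * x) * (deriv (laguerreFun n a) (τ * y) * y))) =
        τ ^ a * (((n : ℝ) + a + 1) / 2 *
            (laguerreFun (n + 1) a (τ * x) * laguerreFun n a (τ * y) +
              laguerreFun n a (τ * x) * laguerreFun (n + 1) a (τ * y)) +
          -(n : ℝ) / 2 * (laguerreFun n a (τ * x) * laguerreFun (n - 1) a (τ * y) +
              laguerreFun (n - 1) a (τ * x) * laguerreFun n a (τ * y))) := fun τ => by
      have h1 := laguerreFun_deriv n a (τ * x)
      have h2 := laguerreFun_deriv n a (τ * y)
      linear_combination τ ^ a / 2 * (laguerreFun n a (τ * y) * h1 + laguerreFun n a (τ * x) * h2)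
    simp only [hint, one_mul] at key
    rw [integral_rpow_mul_lincomb ha (hc (n + 1) n) (hc n (n + 1)) (hc n (n - 1))
      (hc (n - 1) n)] at key
    simp only [scaleIntegral] at ih ⊢
    have hpos : (n : ℝ) + a + 1 ≠ 0 := by
      have : (0 : ℝ) ≤ n := n.cast_nonneg
      linarith
    have hG : Real.Gamma (((n + 1 : ℕ) : ℝ) + a + 1) =
        ((n : ℝ) + a + 1) * Real.Gamma ((n : ℝ) + a + 1) := by
      rw [← Real.Gamma_add_one hpos]
      congr 1
      push_cast
      ring
    have hf : (n.factorial : ℝ) ≠ 0 := by positivity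
    have hn : (n : ℝ) + 1 ≠ 0 := by positivity
    rw [Finset.sum_range_succ, ih, ← key, hG, Nat.factorial_succ, Nat.add_sub_cancel]
    push_cast
    generalize (∫ τ in (0 : ℝ)..1, (_ : ℝ)) = I₁
    generalize (∫ τ in (0 : ℝ)..1, (_ : ℝ)) = I₂
    generalize (∫ τ in (0 : ℝ)..1, (_ : ℝ)) = I₃
    generalize (∫ τ in (0 : ℝ)..1, (_ : ℝ)) = I₄
    field_simp
    ring

theorem rpow_mul_exp_mul_pow {t : ℝ} (ht : 0 < t) (b c : ℝ) (k : ℕ) :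
    t ^ b * (Real.exp (-t / 2) * (c * t ^ k)) =
      c * (t ^ (b + k) * Real.exp (-(1 / 2) * t)) := by
  rw [Real.rpow_add ht, Real.rpow_natCast, show -t / 2 = -(1 / 2) * t by ring]
  ring

theorem integrableOn_rpow_mul_exp_mul_eval {b : ℝ} (hb : -1 < b) (p : Polynomial ℝ) :
    IntegrableOn (fun t : ℝ => t ^ b * (Real.exp (-t / 2) * p.eval t)) (Set.Ioi 0) := by
  induction p using Polynomial.induction_on' with
  | add p q hp hq =>
    simp only [Polynomial.eval_add, mul_add]
    exact hp.add hq
  | monomial k c =>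
    simp only [Polynomial.eval_monomial]
    have hk : -1 < b + k := by
      have : (0 : ℝ) ≤ k := k.cast_nonneg
      linarith
    have h1 := (integrableOn_rpow_mul_exp_neg_mul_rpow (p := 1) (b := 1 / 2) hk one_pos
      (by norm_num)).const_mul c
    refine IntegrableOn.congr_fun h1 (fun t ht => ?_) measurableSet_Ioi
    simp only [Real.rpow_one]
    exact (rpow_mul_exp_mul_pow ht b c k).symm

theorem tendsto_rpow_mul_exp_mul_eval (b : ℝ) (p : Polynomial ℝ) :
    Tendsto (fun t : ℝ => t ^ b * (Real.exp (-t / 2) * p.eval t)) atTop (𝓝 0) := by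
  induction p using Polynomial.induction_on' with
  | add p q hp hq =>
    simp only [Polynomial.eval_add, mul_add]
    simpa using hp.add hq
  | monomial k c =>
    simp only [Polynomial.eval_monomial]
    have h1 := (tendsto_rpow_mul_exp_neg_mul_atTop_nhds_zero (b + k) (1 / 2)
      (by norm_num)).const_mul c
    rw [mul_zero] at h1
    refine h1.congr' ?_
    filter_upwards [eventually_gt_atTop 0] with t ht
    exact (rpow_mul_exp_mul_pow ht b c k).symm

theorem integrableOn_rpow_mul_laguerreFun {s : ℝ} (hs : 0 < s) (n : ℕ) (a : ℝ) :
    IntegrableOn (fun t : ℝ => t ^ (s - 1) * laguerreFun n a t) (Set.Ioi 0) :=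
  integrableOn_rpow_mul_exp_mul_eval (by linarith) _

theorem integral_rpow_mul_laguerreFun_succ {s : ℝ} (hs : 0 < s) (n : ℕ) :
    ((n : ℝ) + 2 * s) * ∫ t in Set.Ioi (0 : ℝ), t ^ (s - 1) * laguerreFun (n + 1) (2 * s - 1) t =
      n * ∫ t in Set.Ioi (0 : ℝ), t ^ (s - 1) * laguerreFun (n - 1) (2 * s - 1) t := by
  set a := 2 * s - 1 with ha
  have i1 := (integrableOn_rpow_mul_laguerreFun hs (n + 1) a).const_mul (n + 2 * s)
  have i2 := (integrableOn_rpow_mul_laguerreFun hs (n - 1) a).const_mul (n : ℝ)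
  have hint : IntegrableOn (fun t : ℝ => 1 / 2 * ((n + 2 * s) * (t ^ (s - 1) *
      laguerreFun (n + 1) a t) - n * (t ^ (s - 1) * laguerreFun (n - 1) a t))) (Set.Ioi 0) :=
    (i1.sub i2).const_mul (1 / 2)
  have key := integral_Ioi_of_hasDerivAt_of_tendsto (a := 0) (m := 0)
    (f := fun t : ℝ => t ^ s * laguerreFun n a t)
    (((Real.continuous_rpow_const hs.le).mul (continuous_laguerreFun n a)).continuousWithinAt)
    (fun t ht => ?_) hint (tendsto_rpow_mul_exp_mul_eval s _)
  · rw [Real.zero_rpow hs.ne', zero_mul, sub_zero, integral_const_mul, integral_sub i1 i2,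
      integral_const_mul, integral_const_mul] at key
    linarith
  · have h1 := (Real.hasDerivAt_rpow_const (p := s) (Or.inl (ne_of_gt ht))).mul
      (hasDerivAt_laguerreFun n a t)
    refine h1.congr_deriv ?_
    have h2 := laguerreFun_deriv n a t
    have h3 : t ^ s = t ^ (s - 1) * t := by
      rw [← Real.rpow_add_one (ne_of_gt ht), sub_add_cancel]
    rw [show (n : ℝ) + a + 1 = n + 2 * s by rw [ha]; ring, show a + 1 = 2 * s by rw [ha]; ring] at h2
    rw [h3]
    linear_combination t ^ (s - 1) / 2 * h2

/-- The moments of odd degree of the Laguerre functions against `t^{s-1}` vanish. They satisfy the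
two-step recursion obtained by integrating the derivative of `t^s e^{-t/2} L_n(t)`. -/
theorem integral_rpow_mul_laguerreFun_eq_zero {s : ℝ} (hs : 0 < s) (m : ℕ) :
    ∫ t in Set.Ioi (0 : ℝ), t ^ (s - 1) * laguerreFun (2 * m + 1) (2 * s - 1) t = 0 := by
  induction m with
  | zero =>
    have h := integral_rpow_mul_laguerreFun_succ hs 0
    simpa [hs.ne'] using h
  | succ m ih =>
    have h := integral_rpow_mul_laguerreFun_succ hs (2 * m + 2)
    rw [show 2 * m + 2 - 1 = 2 * m + 1 by lia, ih, mul_zero] at h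
    refine (mul_eq_zero.1 h).resolve_left ?_
    positivity

/-! ### The Laguerre kernel at finite `N` -/

theorem integral_rpow_mul_eq_scaleIntegral {s : ℝ} (f : ℝ → ℝ) {x : ℝ} (hx : 0 < x) :
    ∫ t in (0 : ℝ)..x, t ^ (s - 1) * f t = x ^ s * scaleIntegral (s - 1) f 1 x 1 := by
  have h := intervalIntegral.integral_comp_mul_right (a := 0) (b := 1)
    (fun t : ℝ => t ^ (s - 1) * f t) hx.ne'
  rw [zero_mul, one_mul, smul_eq_mul, eq_inv_mul_iff_mul_eq₀ hx.ne'] at h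
  rw [← h, scaleIntegral, ← intervalIntegral.integral_const_mul,
    ← intervalIntegral.integral_const_mul]
  refine intervalIntegral.integral_congr fun τ hτ => ?_
  rw [Set.uIcc_of_le zero_le_one] at hτ
  have hxs : x ^ s = x * x ^ (s - 1) := by
    rw [mul_comm, ← Real.rpow_add_one hx.ne', sub_add_cancel]
  simp only [Real.mul_rpow hτ.1 hx.le, Pi.one_apply, hxs]
  ring

theorem integral_Ioi_rpow_mul_laguerreFun {s : ℝ} (hs : 0 < s) (m : ℕ) {x : ℝ} (hx : 0 < x) :
    ∫ t in Set.Ioi x, t ^ (s - 1) * laguerreFun (2 * m + 1) (2 * s - 1) t =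
      -(x ^ s * scaleIntegral (s - 1) (laguerreFun (2 * m + 1) (2 * s - 1)) 1 x 1) := by
  have hi := integrableOn_rpow_mul_laguerreFun hs (2 * m + 1) (2 * s - 1)
  have h := intervalIntegral.integral_Ioi_sub_Ioi hi hx.le
  rw [integral_rpow_mul_laguerreFun_eq_zero hs, integral_rpow_mul_eq_scaleIntegral _ hx] at h
  linarith

theorem sqrt_laguerre_weight {x : ℝ} (hx : 0 < x) (a : ℝ) :
    √(x ^ a * Real.exp (-x)) = x ^ (a / 2) * Real.exp (-x / 2) := by
  rw [Real.sqrt_mul (Real.rpow_nonneg hx.le a), Real.sqrt_eq_rpow, ← Real.rpow_mul hx.le,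
    Real.exp_half]
  ring_nf

theorem laguerreCD_eq (M : ℕ) {a x y : ℝ} (ha : -1 < a) (hx : 0 < x) (hy : 0 < y) :
    laguerreCD M a x y = x ^ (a / 2) * y ^ (a / 2) *
      ∑ j ∈ Finset.range M, Real.Gamma ((j : ℝ) + a + 1) / j.factorial *
        (laguerreFun j a x * laguerreFun j a y) := by
  rw [laguerreCD, sqrt_laguerre_weight hx, sqrt_laguerre_weight hy, Finset.mul_sum, Finset.mul_sum]
  refine Finset.sum_congr rfl fun j _ => ?_
  have h1 : (j.factorial : ℝ) ≠ 0 := by positivity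
  have h2 : Real.Gamma ((j : ℝ) + a + 1) ≠ 0 := by
    have : (0 : ℝ) ≤ j := j.cast_nonneg
    exact (Real.Gamma_pos_of_pos (by linarith)).ne'
  rw [laguerre_eq, laguerre_eq, laguerreFun, laguerreFun]
  field_simp

theorem sqrt_div_mul_rpow {x y : ℝ} (hx : 0 < x) (hy : 0 < y) (s : ℝ) :
    √(x / y) * (x ^ ((2 * s - 1) / 2) * y ^ ((2 * s - 1) / 2)) = x ^ s * y ^ (s - 1) := by
  rw [Real.sqrt_div hx.le, Real.sqrt_eq_rpow, Real.sqrt_eq_rpow, div_eq_mul_inv,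
    ← Real.rpow_neg hy.le, mul_mul_mul_comm, ← Real.rpow_add hx, ← Real.rpow_add hy]
  ring_nf

/-- The common form of the Laguerre kernel and of its limit: `f` and `g` stand for the two Laguerre
functions of highest degree, or both for the Bessel–Clifford function of order `2s - 1`. -/
noncomputable def symplecticForm (s : ℝ) (f g : ℝ → ℝ) (x y : ℝ) : ℝ :=
  scaleIntegral (2 * s - 1) f g x y + scaleIntegral (2 * s - 1) g f x y -
    f y * scaleIntegral (s - 1) g 1 x 1

/-- The unscaled kernel in terms of the Laguerre functions of degrees `2N` and `2N - 1`. That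
`2N - 1` is odd is what turns the integral over `(x, ∞)` into one over `(0, x)`. -/
theorem laguerreS4tilde_eq {s : ℝ} (hs : 0 < s) {N : ℕ} (hN : N ≠ 0) {x y : ℝ} (hx : 0 < x)
    (hy : 0 < y) :
    laguerreS4tilde N (2 * s - 1) x y =
      ((2 * N : ℕ) : ℝ) * Real.Gamma (((2 * N : ℕ) : ℝ) + 2 * s) / (2 * N).factorial / 4 *
        (x ^ s * y ^ (s - 1)) *
        symplecticForm s (laguerreFun (2 * N) (2 * s - 1))
          (laguerreFun (2 * N - 1) (2 * s - 1)) x y := by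
  obtain ⟨m, rfl⟩ := Nat.exists_eq_succ_of_ne_zero hN
  have hM : 2 * m.succ = 2 * m + 1 + 1 := by lia
  have hpos : (0 : ℝ) < ((2 * m + 1 : ℕ) : ℝ) + 2 * s := by positivity
  have hG : Real.Gamma (((2 * m + 1 : ℕ) : ℝ) + 2 * s) ≠ 0 := (Real.Gamma_pos_of_pos hpos).ne'
  have hint : ∀ t, t ^ ((2 * s - 1 - 1) / 2) * Real.exp (-t / 2) *
      laguerre (2 * m + 1) (2 * s - 1) t =
      Real.Gamma (((2 * m + 1 : ℕ) : ℝ) + 2 * s) / (2 * m + 1).factorial *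
      (t ^ (s - 1) * laguerreFun (2 * m + 1) (2 * s - 1) t) := fun t => by
    rw [laguerre_eq, laguerreFun, show (2 * s - 1 - 1) / 2 = s - 1 by ring,
      show ((2 * m + 1 : ℕ) : ℝ) + (2 * s - 1) + 1 = ((2 * m + 1 : ℕ) : ℝ) + 2 * s by ring]
    ring
  have hy' : y ^ ((2 * s - 1 - 1) / 2) * Real.exp (-y / 2) *
      laguerre (2 * m + 1 + 1) (2 * s - 1) y =
      Real.Gamma (((2 * m + 1 + 1 : ℕ) : ℝ) + 2 * s) / (2 * m + 1 + 1).factorial *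
      (y ^ (s - 1) * laguerreFun (2 * m + 1 + 1) (2 * s - 1) y) := by
    rw [laguerre_eq, laguerreFun, show (2 * s - 1 - 1) / 2 = s - 1 by ring,
      show ((2 * m + 1 + 1 : ℕ) : ℝ) + (2 * s - 1) + 1 = ((2 * m + 1 + 1 : ℕ) : ℝ) + 2 * s by ring]
    ring
  have hGa : 2 * s - 1 + 2 * ((m.succ : ℕ) : ℝ) = ((2 * m + 1 : ℕ) : ℝ) + 2 * s := by
    push_cast
    ring
  have hGb : ((2 * m + 1 + 1 : ℕ) : ℝ) + (2 * s - 1) + 1 = ((2 * m + 1 + 1 : ℕ) : ℝ) + 2 * s := by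
    ring
  have hsq := sqrt_div_mul_rpow hx hy s
  rw [laguerreS4tilde, laguerreCD_eq _ (by linarith) hx hy, sum_laguerreFun_eq (by linarith), hGa,
    hM, Nat.add_sub_cancel]
  simp only [hint]
  rw [integral_const_mul, integral_Ioi_rpow_mul_laguerreFun hs m hx,
    mul_assoc ((2 * m + 1 + 1).factorial : ℝ), mul_assoc ((2 * m + 1 + 1).factorial : ℝ), hy', hGb,
    ← hsq, symplecticForm]
  have hf : ((2 * m + 1 + 1).factorial : ℝ) = ((2 * m + 1 + 1 : ℕ) : ℝ) * (2 * m + 1).factorial := by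
    rw [Nat.factorial_succ]
    push_cast
    ring
  have h1 : ((2 * m + 1).factorial : ℝ) ≠ 0 := by positivity
  have h2 : ((2 * m + 1 + 1 : ℕ) : ℝ) ≠ 0 := by positivity
  rw [hf]
  rw [mul_assoc (1 / 2 : ℝ), ← mul_assoc (√(x / y)), hsq]
  field_simp
  ring

/-- The Laguerre function of degree `M - j` at `x / M`, with `x` the hard edge variable. -/
noncomputable def scaledLaguerre (a : ℝ) (j M : ℕ) (x : ℝ) : ℝ :=
  laguerreFun (M - j) a (x / M)

theorem scaleIntegral_comp_div (b c : ℝ) (f g : ℝ → ℝ) (x y : ℝ) :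
    scaleIntegral b f g (x / c) (y / c) =
      scaleIntegral b (fun x => f (x / c)) (fun y => g (y / c)) x y := by
  simp only [scaleIntegral, mul_div_assoc]

/-- The normalisation constant of the rescaled kernel on `M` Laguerre polynomials; it tends
to `1`. -/
noncomputable def kernelConst (s : ℝ) (M : ℕ) : ℝ :=
  (M : ℝ) * Real.Gamma ((M : ℝ) + 2 * s) / M.factorial / (M : ℝ) ^ (2 * s)

theorem scaledS4_eq {s : ℝ} (hs : 0 < s) {N : ℕ} (hN : N ≠ 0) {x y : ℝ} (hx : 0 < x)
    (hy : 0 < y) :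
    scaledS4 s N x y = x ^ s * y ^ (s - 1) * (kernelConst s (2 * N) / 4 *
      symplecticForm s (scaledLaguerre (2 * s - 1) 0 (2 * N))
        (scaledLaguerre (2 * s - 1) 1 (2 * N)) x y) := by
  have hM : (0 : ℝ) < ((2 * N : ℕ) : ℝ) := by positivity
  have hN' : (N : ℝ) ≠ 0 := by exact_mod_cast hN
  have hdiv : ∀ z : ℝ, 2 * (z / (4 * (N : ℝ))) = z / ((2 * N : ℕ) : ℝ) := fun z => by
    push_cast
    field_simp
    ring
  have hone : scaleIntegral (s - 1) (laguerreFun (2 * N - 1) (2 * s - 1)) 1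
      (x / ((2 * N : ℕ) : ℝ)) 1 =
      scaleIntegral (s - 1) (scaledLaguerre (2 * s - 1) 1 (2 * N)) 1 x 1 := by
    simp only [scaleIntegral, scaledLaguerre, mul_div_assoc, Pi.one_apply]
  have hform : symplecticForm s (laguerreFun (2 * N) (2 * s - 1))
      (laguerreFun (2 * N - 1) (2 * s - 1)) (x / ((2 * N : ℕ) : ℝ)) (y / ((2 * N : ℕ) : ℝ)) =
      symplecticForm s (scaledLaguerre (2 * s - 1) 0 (2 * N))
        (scaledLaguerre (2 * s - 1) 1 (2 * N)) x y := by
    rw [symplecticForm, symplecticForm, scaleIntegral_comp_div, scaleIntegral_comp_div, hone]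
    rfl
  rw [scaledS4, laguerreS4, hdiv, hdiv,
    laguerreS4tilde_eq hs hN (div_pos hx hM) (div_pos hy hM), hform, kernelConst,
    Real.div_rpow hx.le hM.le, Real.div_rpow hy.le hM.le]
  have hpow : ((2 * N : ℕ) : ℝ) ^ (2 * s) =
      ((2 * N : ℕ) : ℝ) ^ s * ((2 * N : ℕ) : ℝ) ^ (s - 1) * ((2 * N : ℕ) : ℝ) := by
    rw [mul_assoc, ← Real.rpow_add_one hM.ne', sub_add_cancel, ← Real.rpow_add hM]
    ring_nf
  have h4 : 1 / (4 * (N : ℝ)) * 2 = 1 / ((2 * N : ℕ) : ℝ) := by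
    push_cast
    field_simp
    norm_num
  rw [hpow, ← mul_assoc, h4]
  have p1 := (Real.rpow_pos_of_pos hM s).ne'
  have p2 := (Real.rpow_pos_of_pos hM (s - 1)).ne'
  have p3 : ((2 * N).factorial : ℝ) ≠ 0 := by positivity
  have p4 := hM.ne'
  field_simp

/-! ### The hard edge limit of the Laguerre functions -/

theorem descFactorial_div_pow_le_one (j k M : ℕ) :
    |((M - j).descFactorial k : ℝ) / (M : ℝ) ^ k| ≤ 1 := by
  rw [abs_of_nonneg (by positivity)]
  refine div_le_one_of_le₀ ?_ (by positivity)
  exact_mod_cast (Nat.descFactorial_le_pow _ _).trans (Nat.pow_le_pow_left (Nat.sub_le M j) k)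

theorem tendsto_cast_sub_div (j : ℕ) :
    Tendsto (fun M : ℕ => ((M - j : ℕ) : ℝ) / M) atTop (𝓝 1) := by
  have h := (tendsto_const_div_atTop_nhds_zero_nat (j : ℝ)).const_sub 1
  rw [sub_zero] at h
  refine h.congr' ?_
  filter_upwards [eventually_ge_atTop (j + 1)] with M hM
  have : (M : ℝ) ≠ 0 := by
    have : M ≠ 0 := by lia
    exact_mod_cast this
  rw [Nat.cast_sub (by lia)]
  field_simp

theorem tendsto_descFactorial_div_pow (j k : ℕ) :
    Tendsto (fun M : ℕ => ((M - j).descFactorial k : ℝ) / (M : ℝ) ^ k) atTop (𝓝 1) := by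
  induction k with
  | zero => simp
  | succ k ih =>
    have h := (tendsto_cast_sub_div (j + k)).mul ih
    rw [one_mul] at h
    refine h.congr fun M => ?_
    rw [Nat.descFactorial_succ, Nat.sub_sub, pow_succ', Nat.cast_mul, mul_div_mul_comm]

theorem tendstoC1_scaledLaguerre (a : ℝ) (j : ℕ) :
    TendstoC1 (scaledLaguerre a j) (clifford a) := by
  have h0 : Tendsto (fun M : ℕ => 1 / 2 / (M : ℝ)) atTop (𝓝 0) :=
    tendsto_const_div_atTop_nhds_zero_nat _
  have h := (TendstoC1.exp_neg h0).mul
    (TendstoC1.cliffordSeries (w := fun M k => ((M - j).descFactorial k : ℝ) / (M : ℝ) ^ k)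
      (fun M k => descFactorial_div_pow_le_one j k M)
      (fun k => tendsto_descFactorial_div_pow j k) a)
  convert h using 1
  · funext M x
    rw [scaledLaguerre, laguerreFun, normLaguerre_eval_div]
    congr 2
    ring
  · simp

theorem prod_add_eq_Gamma {z : ℝ} (hz : 0 < z) (n : ℕ) :
    (∏ j ∈ Finset.range n, (z + j)) * Real.Gamma z = Real.Gamma (z + n) := by
  induction n with
  | zero => simp
  | succ n ih =>
    rw [Finset.prod_range_succ, mul_right_comm, ih, Nat.cast_succ, ← add_assoc,
      Real.Gamma_add_one (by positivity), mul_comm]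

/-- The inverse of the constant is Euler's sequence for `Γ(2s)` over `Γ(2s)`, up to the factor
`1 + 2s / M`. -/
theorem tendsto_kernelConst {s : ℝ} (hs : 0 < s) :
    Tendsto (kernelConst s) atTop (𝓝 1) := by
  have hz : 0 < 2 * s := by positivity
  have hG : Real.Gamma (2 * s) ≠ 0 := (Real.Gamma_pos_of_pos hz).ne'
  have h1 := ((Real.GammaSeq_tendsto_Gamma (2 * s)).div_const (Real.Gamma (2 * s))).inv₀
    (by rw [div_self hG]; exact one_ne_zero)
  have h2 := h1.mul
    (((tendsto_const_div_atTop_nhds_zero_nat (2 * s)).const_add 1).inv₀ (by simp))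
  simp only [div_self hG, inv_one, add_zero, mul_one] at h2
  refine h2.congr' ?_
  filter_upwards [eventually_gt_atTop 0] with n hn
  have hn' : (0 : ℝ) < n := by exact_mod_cast hn
  have hp := prod_add_eq_Gamma hz n
  have hprod : (∏ j ∈ Finset.range n, (2 * s + (j : ℝ))) ≠ 0 :=
    Finset.prod_ne_zero_iff.2 fun j _ => by positivity
  have hf : (n.factorial : ℝ) ≠ 0 := by positivity
  have hpw := (Real.rpow_pos_of_pos hn' (2 * s)).ne'
  have h3 : 2 * s + (n : ℝ) ≠ 0 := by positivity
  rw [kernelConst, Real.GammaSeq, Finset.prod_range_succ, add_comm (n : ℝ), ← hp]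
  have h4 : (n : ℝ) ≠ 0 := hn'.ne'
  have h5 : 1 + 2 * s / (n : ℝ) = (2 * s + n) / n := by
    field_simp
    ring
  rw [h5]
  field_simp

/-! ### Bessel kernels in terms of Bessel–Clifford functions -/

theorem besselJ_recurrence {t : ℝ} (ht : 0 < t) (ν : ℝ) :
    t * besselJ (ν + 2) (2 * t) = (ν + 1) * besselJ (ν + 1) (2 * t) - t * besselJ ν (2 * t) := by
  rw [besselJ_two_mul ht, besselJ_two_mul ht, besselJ_two_mul ht, Real.rpow_add ht,
    Real.rpow_add_one ht.ne', Real.rpow_two]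
  linear_combination t ^ ν * t * clifford_recurrence ν (t ^ 2)

theorem sqrt_four_mul (x : ℝ) : √(4 * x) = 2 * √x := by
  rw [Real.sqrt_mul (by norm_num), show (4 : ℝ) = 2 ^ 2 by norm_num, Real.sqrt_sq (by norm_num)]

theorem hasDerivAt_clifford_mul (ν x τ : ℝ) :
    HasDerivAt (fun τ => clifford ν (τ * x)) (-clifford (ν + 1) (τ * x) * x) τ :=
  HasDerivAt.comp (h₂ := clifford ν) τ (hasDerivAt_clifford ν (τ * x)) (hasDerivAt_mul_const x)

theorem continuous_clifford_mul (ν x : ℝ) : Continuous fun τ => clifford ν (τ * x) :=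
  (continuous_clifford ν).comp (continuous_mul_const x)

/-- Lommel's integral off the diagonal: `τ^(ν+1)` times the right-hand side at `(τx, τy)` is an
antiderivative of the integrand. -/
theorem scaleIntegral_clifford_of_ne {ν : ℝ} (hν : -1 < ν) {x y : ℝ} (hxy : x ≠ y) :
    scaleIntegral ν (clifford ν) (clifford ν) x y =
      (x * clifford (ν + 1) x * clifford ν y - y * clifford (ν + 1) y * clifford ν x) /
        (x - y) := by
  have h0 : x - y ≠ 0 := sub_ne_zero.2 hxy
  have c0 := fun z => continuous_clifford_mul ν z
  have c1 := fun z => continuous_clifford_mul (ν + 1) z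
  have c2 := fun z => continuous_clifford_mul (ν + 1 + 1) z
  have key := integral_rpow_mul_deriv hν
    (h := fun τ => (x * (clifford (ν + 1) (τ * x) * clifford ν (τ * y)) -
      y * (clifford (ν + 1) (τ * y) * clifford ν (τ * x))) / (x - y))
    (fun τ => (((((hasDerivAt_clifford_mul (ν + 1) x τ).fun_mul
      (hasDerivAt_clifford_mul ν y τ)).const_mul x).sub
      (((hasDerivAt_clifford_mul (ν + 1) y τ).fun_mul
      (hasDerivAt_clifford_mul ν x τ)).const_mul y)).div_const (x - y)))
    (by fun_prop)
  simp only [one_mul] at key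
  rw [mul_assoc x, mul_assoc y, ← key, scaleIntegral]
  refine intervalIntegral.integral_congr fun τ _ => ?_
  have e1 := clifford_recurrence ν (τ * x)
  have e2 := clifford_recurrence ν (τ * y)
  rw [show ν + 2 = ν + 1 + 1 by ring] at e1 e2
  have h1 : (x - y)⁻¹ * (x - y) = 1 := inv_mul_cancel₀ h0
  simp only [div_eq_mul_inv]
  linear_combination (x - y)⁻¹ * τ ^ ν * (x * clifford ν (τ * y) * e1
    - y * clifford ν (τ * x) * e2) - τ ^ ν * clifford ν (τ * x) * clifford ν (τ * y) * h1

/-- Lommel's integral on the diagonal, with the same kind of antiderivative. -/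
theorem scaleIntegral_clifford_self {ν : ℝ} (hν : -1 < ν) (x : ℝ) :
    scaleIntegral ν (clifford ν) (clifford ν) x x =
      clifford ν x ^ 2 - ν * clifford ν x * clifford (ν + 1) x + x * clifford (ν + 1) x ^ 2 := by
  have c0 := continuous_clifford_mul ν x
  have c1 := continuous_clifford_mul (ν + 1) x
  have c2 := continuous_clifford_mul (ν + 1 + 1) x
  have d0 := fun τ => hasDerivAt_clifford_mul ν x τ
  have d1 := fun τ => hasDerivAt_clifford_mul (ν + 1) x τ
  have key := integral_rpow_mul_deriv hν
    (h := fun τ => clifford ν (τ * x) * clifford ν (τ * x)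
      - ν * (clifford ν (τ * x) * clifford (ν + 1) (τ * x))
      + τ * x * (clifford (ν + 1) (τ * x) * clifford (ν + 1) (τ * x)))
    (fun τ => (((d0 τ).fun_mul (d0 τ)).sub (((d0 τ).fun_mul (d1 τ)).const_mul ν)).add
      ((hasDerivAt_mul_const x).fun_mul ((d1 τ).fun_mul (d1 τ))))
    (by fun_prop)
  simp only [one_mul] at key
  rw [pow_two, pow_two, mul_assoc ν, ← key, scaleIntegral]
  refine intervalIntegral.integral_congr fun τ _ => ?_
  have e1 := clifford_recurrence ν (τ * x)
  rw [show ν + 2 = ν + 1 + 1 by ring] at e1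
  linear_combination τ ^ ν * (-ν * clifford ν (τ * x)
    + 2 * (τ * x) * clifford (ν + 1) (τ * x)) * e1

theorem besselKernel2_eq {ν : ℝ} (hν : -1 < ν) {x y : ℝ} (hx : 0 < x) (hy : 0 < y) :
    besselKernel2 ν (4 * x) (4 * y) =
      1 / 4 * (x ^ (ν / 2) * y ^ (ν / 2)) * scaleIntegral ν (clifford ν) (clifford ν) x y := by
  have hJ1 : ∀ {z : ℝ}, 0 < z → √z * besselJ (ν + 1) (2 * √z) =
      z ^ (ν / 2) * (z * clifford (ν + 1) z) := fun {z} hz => by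
    rw [besselJ_two_mul_sqrt hz, show (ν + 1) / 2 = ν / 2 + 1 / 2 by ring, Real.rpow_add hz,
      ← Real.sqrt_eq_rpow]
    linear_combination z ^ (ν / 2) * clifford (ν + 1) z * Real.mul_self_sqrt hz.le
  rw [besselKernel2, sqrt_four_mul, sqrt_four_mul]
  rcases eq_or_ne x y with rfl | hxy
  · have hrec := besselJ_recurrence (Real.sqrt_pos.2 hx) (ν - 1)
    rw [show ν - 1 + 2 = ν + 1 by ring, sub_add_cancel] at hrec
    have hr := (Real.sqrt_pos.2 hx).ne'
    have h1 := hJ1 hx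
    have h0 := besselJ_two_mul_sqrt hx ν
    have hsq : √x ^ 2 = x := Real.sq_sqrt hx.le
    rw [if_pos rfl, scaleIntegral_clifford_self hν]
    -- the recurrence eliminates the Bessel function of order `ν - 1`
    have h2 : x * (besselJ (ν + 1) (2 * √x) * besselJ (ν - 1) (2 * √x)) =
        (√x * besselJ (ν + 1) (2 * √x)) * (ν * besselJ ν (2 * √x)
          - √x * besselJ (ν + 1) (2 * √x)) := by
      linear_combination (-(besselJ (ν + 1) (2 * √x) * besselJ (ν - 1) (2 * √x))) * hsq +
        √x * besselJ (ν + 1) (2 * √x) * hrec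
    rw [h1, h0] at h2
    rw [h0]
    refine mul_left_cancel₀ hx.ne' ?_
    linear_combination (-1 / 4) * h2
  · have h4 : 4 * x ≠ 4 * y := fun h => hxy (by linarith)
    have h0 : x - y ≠ 0 := sub_ne_zero.2 hxy
    rw [if_neg h4, scaleIntegral_clifford_of_ne hν hxy, mul_assoc 2 (√x), mul_assoc 2 (√y), hJ1 hx,
      hJ1 hy, besselJ_two_mul_sqrt hx, besselJ_two_mul_sqrt hy, ← mul_sub 4 x y]
    field_simp

/-- The substitution `u = τ^2`. -/
theorem integral_rpow_mul_comp_sq {s : ℝ} (hs : 0 < s) {h : ℝ → ℝ} (hh : Continuous h) :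
    ∫ τ in (0 : ℝ)..1, τ ^ (2 * s - 1) * h (τ ^ 2) =
      1 / 2 * ∫ τ in (0 : ℝ)..1, τ ^ (s - 1) * h τ := by
  have hcongr : ∀ τ : ℝ, 0 < τ →
      (τ ^ 2) ^ (s - 1) * h (τ ^ 2) * (2 * τ) = 2 * (τ ^ (2 * s - 1) * h (τ ^ 2)) := by
    intro τ hτ
    have : τ ^ (2 * s - 1) = (τ ^ 2) ^ (s - 1) * τ := by
      rw [← Real.rpow_two, ← Real.rpow_mul hτ.le, ← Real.rpow_add_one hτ.ne']
      ring_nf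
    rw [this]
    ring
  have hI1 : IntegrableOn (fun u : ℝ => u ^ (s - 1) * h u) (Set.Icc 0 1) :=
    (intervalIntegrable_iff_integrableOn_Icc_of_le zero_le_one).1
      (intervalIntegrable_rpow_mul_continuous (by linarith) hh)
  have hI2 : IntegrableOn (fun τ : ℝ => (τ ^ 2) ^ (s - 1) * h (τ ^ 2) * (2 * τ))
      (Set.Icc 0 1) := by
    rw [integrableOn_Icc_iff_integrableOn_Ioc]
    have h1 := ((intervalIntegrable_iff_integrableOn_Ioc_of_le zero_le_one).1
      (intervalIntegrable_rpow_mul_continuous (b := 2 * s - 1) (h := fun τ => h (τ ^ 2))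
        (by linarith) (hh.comp (continuous_pow 2)))).const_mul 2
    exact IntegrableOn.congr_fun h1 (fun τ hτ => (hcongr τ hτ.1).symm) measurableSet_Ioc
  have hIcc : Set.uIcc (0 : ℝ) 1 = Set.Icc 0 1 := Set.uIcc_of_le zero_le_one
  have key := intervalIntegral.integral_comp_mul_deriv''' (a := 0) (b := 1)
    (f := fun τ : ℝ => τ ^ 2) (f' := fun τ => 2 * τ) (g := fun u : ℝ => u ^ (s - 1) * h u)
    (continuous_pow 2).continuousOn
    (fun τ _ => by simpa using (hasDerivAt_pow 2 τ).hasDerivWithinAt) ?_ ?_ ?_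
  · simp only [Function.comp_def] at key
    rw [zero_pow two_ne_zero, one_pow] at key
    rw [← key, ← intervalIntegral.integral_const_mul]
    refine intervalIntegral.integral_congr_Ioo_of_le zero_le_one fun τ hτ => ?_
    simp only [hcongr τ hτ.1]
    ring
  · rintro _ ⟨τ, hτ, rfl⟩
    rw [min_eq_left zero_le_one] at hτ
    exact ((Real.continuousAt_rpow_const _ _ (Or.inl (pow_pos hτ.1 2).ne')).mul
      hh.continuousAt).continuousWithinAt
  · rw [hIcc]
    refine hI1.mono_set ?_
    rintro _ ⟨τ, hτ, rfl⟩
    exact ⟨sq_nonneg τ, pow_le_one₀ hτ.1 hτ.2⟩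
  · rw [hIcc]
    exact hI2

theorem integral_besselJ_two_mul {s : ℝ} (hs : 0 < s) {x : ℝ} (hx : 0 < x) :
    ∫ t in (0 : ℝ)..√x, besselJ (2 * s - 1) (2 * t) =
      1 / 2 * x ^ s * scaleIntegral (s - 1) (clifford (2 * s - 1)) 1 x 1 := by
  have hr := Real.sqrt_pos.2 hx
  have h1 : ∫ t in (0 : ℝ)..√x, besselJ (2 * s - 1) (2 * t) =
      ∫ t in (0 : ℝ)..√x, t ^ (2 * s - 1) * clifford (2 * s - 1) (t ^ 2) :=
    intervalIntegral.integral_congr_Ioo_of_le hr.le fun t ht => besselJ_two_mul ht.1 _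
  have h2 := integral_rpow_mul_comp_sq hs (continuous_clifford_mul (2 * s - 1) x)
  have h3 : √x ^ (2 * s) = x ^ s := by
    rw [Real.sqrt_eq_rpow, ← Real.rpow_mul hx.le]
    ring_nf
  rw [h1, integral_rpow_mul_eq_scaleIntegral (s := 2 * s)
    (fun t => clifford (2 * s - 1) (t ^ 2)) hr, h3]
  simp only [scaleIntegral, mul_pow, Real.sq_sqrt hx.le, Pi.one_apply, mul_one] at h2 ⊢
  rw [h2]
  ring

theorem besselKernel_eq {s : ℝ} (hs : 0 < s) {x y : ℝ} (hx : 0 < x) (hy : 0 < y) :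
    besselKernel s x y = x ^ s * y ^ (s - 1) *
      (1 / 4 * symplecticForm s (clifford (2 * s - 1)) (clifford (2 * s - 1)) x y) := by
  have hq := (Real.sqrt_pos.2 hy).ne'
  have hJ : besselJ (2 * s - 1) (2 * √y) / (2 * √y) =
      1 / 2 * y ^ (s - 1) * clifford (2 * s - 1) y := by
    rw [besselJ_two_mul_sqrt hy, show (2 * s - 1) / 2 = s - 1 + 1 / 2 by ring, Real.rpow_add hy,
      ← Real.sqrt_eq_rpow]
    field_simp
  rw [besselKernel, besselKernel2_eq (by linarith) hx hy, integral_besselJ_two_mul hs hx, hJ,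
    ← sqrt_div_mul_rpow hx hy s, symplecticForm]
  have h1 := sqrt_div_mul_rpow hx hy s
  linear_combination (1 / 4 * clifford (2 * s - 1) y *
    scaleIntegral (s - 1) (clifford (2 * s - 1)) 1 x 1) * h1

theorem intervalIntegrable_besselJ {ν : ℝ} (hν : -1 < ν) {r : ℝ} (hr : 0 ≤ r) :
    IntervalIntegrable (fun t => besselJ ν (2 * t)) volume 0 r := by
  have h1 : IntervalIntegrable (fun t => t ^ ν * clifford ν (t ^ 2)) volume 0 r :=
    (intervalIntegral.intervalIntegrable_rpow' hν).mul_continuousOn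
      ((continuous_clifford ν).comp (continuous_pow 2)).continuousOn
  rw [intervalIntegrable_iff_integrableOn_Ioc_of_le hr] at h1 ⊢
  exact h1.congr_fun (fun t ht => (besselJ_two_mul ht.1 ν).symm) measurableSet_Ioc

/-- The integrated form of `J_{ν-1} - J_{ν+1} = 2 J_ν'`. -/
theorem integral_besselJ_sub {ν : ℝ} (hν : -1 < ν) {r : ℝ} (hr : 0 < r) :
    (∫ t in (0 : ℝ)..r, besselJ ν (2 * t)) - ∫ t in (0 : ℝ)..r, besselJ (ν + 2) (2 * t) =
      besselJ (ν + 1) (2 * r) := by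
  have i1 := intervalIntegrable_besselJ hν hr.le
  have i2 := intervalIntegrable_besselJ (ν := ν + 2) (by linarith) hr.le
  rw [← intervalIntegral.integral_sub i1 i2, besselJ_two_mul hr]
  have hν1 : ν + 1 ≠ 0 := by linarith
  have key := intervalIntegral.integral_eq_sub_of_hasDerivAt_of_le (a := 0) (b := r)
    (f := fun t => t ^ (ν + 1) * clifford (ν + 1) (t ^ 2)) hr.le
    ((Real.continuous_rpow_const (by linarith)).mul
      ((continuous_clifford _).comp (continuous_pow 2))).continuousOn (fun t ht => ?_) (i1.sub i2)
  · rw [key, Real.zero_rpow hν1, zero_mul, sub_zero]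
  · have hc : HasDerivAt (fun t : ℝ => clifford (ν + 1) (t ^ 2))
        (-clifford (ν + 1 + 1) (t ^ 2) * (2 * t)) t :=
      HasDerivAt.comp (h₂ := clifford (ν + 1)) t (hasDerivAt_clifford (ν + 1) (t ^ 2))
        (by simpa using hasDerivAt_pow 2 t)
    refine ((Real.hasDerivAt_rpow_const (p := ν + 1) (Or.inl ht.1.ne')).mul hc).congr_deriv ?_
    rw [besselJ_two_mul ht.1, besselJ_two_mul ht.1, clifford_recurrence ν (t ^ 2),
      add_sub_cancel_right, Real.rpow_add_one ht.1.ne', Real.rpow_add ht.1, Real.rpow_two,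
      show ν + 1 + 1 = ν + 2 by ring]
    ring

/-- Raising the order of the determinantal Bessel kernel by one. -/
theorem besselKernel2_shift {ν : ℝ} {x y : ℝ} (hx : 0 < x) (hy : 0 < y) :
    2 * √(x / y) * besselKernel2 ν (4 * x) (4 * y) =
      2 * besselKernel2 (ν + 1) (4 * x) (4 * y) +
        besselJ ν (2 * √y) / (2 * √y) * besselJ (ν + 1) (2 * √x) := by
  have hr := Real.sqrt_pos.2 hx
  have hq := Real.sqrt_pos.2 hy
  have rx := besselJ_recurrence hr ν
  have ry := besselJ_recurrence hq ν
  have sx : √x ^ 2 = x := Real.sq_sqrt hx.le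
  have sy : √y ^ 2 = y := Real.sq_sqrt hy.le
  simp only [besselKernel2, sqrt_four_mul, Real.sqrt_div hx.le, add_sub_cancel_right,
    show ν + 1 + 1 = ν + 2 by ring]
  rcases eq_or_ne x y with rfl | hxy
  · have rx' := besselJ_recurrence hr (ν - 1)
    rw [show ν - 1 + 2 = ν + 1 by ring, sub_add_cancel] at rx'
    simp only [if_true, div_self hr.ne']
    have hr' := hr.ne'
    field_simp
    linear_combination 4 * besselJ ν (2 * √x) * rx - 4 * besselJ (ν + 1) (2 * √x) * rx'
  · have h4 : 4 * x ≠ 4 * y := fun h => hxy (by linarith)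
    have h0 : √x ^ 2 - √y ^ 2 ≠ 0 := by rw [sx, sy]; exact sub_ne_zero.2 hxy
    have hq' := hq.ne'
    rw [if_neg h4, if_neg h4, ← mul_sub 4 x y, mul_assoc 2 (√x) (besselJ (ν + 2) _),
      mul_assoc 2 (√y) (besselJ (ν + 2) _), rx, ry]
    have e : x - y = √x ^ 2 - √y ^ 2 := by rw [sx, sy]
    rw [e]
    field_simp
    ring

/-! ### Convergence of the rescaled kernels -/

theorem TendstoC1.symplecticForm_left {f g : ℕ → ℝ → ℝ} {h k : ℝ → ℝ} (hf : TendstoC1 f h)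
    (hg : TendstoC1 g k) {s : ℝ} (hs : 0 < s) (y : ℝ) :
    TendstoC1 (fun n x => symplecticForm s (f n) (g n) x y)
      (fun x => symplecticForm s h k x y) := by
  have h1 : -1 < 2 * s - 1 := by linarith
  have h2 := (const_seq (hf.tendsto y).neg).mul
    (hg.scaleIntegral (const 1) (b := s - 1) (by linarith) 1)
  have h3 := ((hf.scaleIntegral hg h1 y).add (hg.scaleIntegral hf h1 y)).add h2
  simp only [neg_mul, ← sub_eq_add_neg] at h3
  exact h3

theorem TendstoC1.symplecticForm_right {f g : ℕ → ℝ → ℝ} {h k : ℝ → ℝ} (hf : TendstoC1 f h)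
    (hg : TendstoC1 g k) {s : ℝ} (hs : 0 < s) (x : ℝ) :
    TendstoC1 (fun n y => symplecticForm s (f n) (g n) x y)
      (fun y => symplecticForm s h k x y) := by
  have h1 : -1 < 2 * s - 1 := by linarith
  have h2 := hf.mul (const_seq
    ((hg.scaleIntegral (const 1) (b := s - 1) (by linarith) 1).tendsto x).neg)
  have h3 := ((hg.scaleIntegral hf h1 x).add (hf.scaleIntegral hg h1 x)).add h2
  simp only [mul_neg, ← sub_eq_add_neg, scaleIntegral_comm (2 * s - 1) _ _ _ x] at h3
  exact h3

theorem TendstoC1.comp_tendsto {f : ℕ → ℝ → ℝ} {g : ℝ → ℝ} (h : TendstoC1 f g) {φ : ℕ → ℕ}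
    (hφ : Tendsto φ atTop atTop) : TendstoC1 (fun n => f (φ n)) g where
  differentiable n := h.differentiable (φ n)
  differentiable_lim := h.differentiable_lim
  tendsto x := (h.tendsto x).comp hφ
  tendsto_deriv x := (h.tendsto_deriv x).comp hφ
  bound R := (h.bound R).imp fun _ hC n => hC (φ n)
  bound_deriv R := (h.bound_deriv R).imp fun _ hC n => hC (φ n)

theorem TendstoC1.tendsto_deriv_mul {f : ℕ → ℝ → ℝ} {g p : ℝ → ℝ} (h : TendstoC1 f g) {x : ℝ}
    (hp : DifferentiableAt ℝ p x) :
    Tendsto (fun n => deriv (fun u => p u * f n u) x) atTop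
      (𝓝 (deriv (fun u => p u * g u) x)) := by
  rw [deriv_fun_mul hp (h.differentiable_lim x)]
  simp only [fun n => deriv_fun_mul hp (h.differentiable n x)]
  exact ((h.tendsto x).const_mul _).add ((h.tendsto_deriv x).const_mul _)

theorem TendstoC1.tendsto_integral_mul {f : ℕ → ℝ → ℝ} {g p : ℝ → ℝ} (h : TendstoC1 f g) {a b : ℝ}
    (hp : ContinuousOn p (Set.uIcc a b)) :
    Tendsto (fun n => ∫ t in a..b, p t * f n t) atTop (𝓝 (∫ t in a..b, p t * g t)) := by
  obtain ⟨C, hC⟩ := isCompact_uIcc.exists_bound_of_continuousOn hp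
  obtain ⟨R, hR⟩ := (isCompact_uIcc (a := a) (b := b)).exists_bound_of_continuousOn continuousOn_id
  obtain ⟨D, hD⟩ := h.bound R
  refine intervalIntegral.tendsto_integral_filter_of_dominated_convergence (fun _ => C * D)
    (Eventually.of_forall fun n => ?_)
    (Eventually.of_forall fun n => Eventually.of_forall fun t ht => ?_)
    intervalIntegrable_const (Eventually.of_forall fun t _ => (h.tendsto t).const_mul _)
  · exact ((hp.mul (h.differentiable n).continuous.continuousOn).mono
      Set.uIoc_subset_uIcc).aestronglyMeasurable measurableSet_uIoc
  · have h1 := hC t (Set.uIoc_subset_uIcc ht)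
    rw [norm_mul]
    exact mul_le_mul h1 (hD n t (hR t (Set.uIoc_subset_uIcc ht))) (norm_nonneg _)
      ((norm_nonneg _).trans h1)

/-- The smooth factor of the rescaled Laguerre kernel. -/
noncomputable def laguerreFactor (s : ℝ) (N : ℕ) (x y : ℝ) : ℝ :=
  kernelConst s (2 * N) / 4 * symplecticForm s (scaledLaguerre (2 * s - 1) 0 (2 * N))
    (scaledLaguerre (2 * s - 1) 1 (2 * N)) x y

/-- The smooth factor of the Bessel kernel. -/
noncomputable def besselFactor (s x y : ℝ) : ℝ :=
  1 / 4 * symplecticForm s (clifford (2 * s - 1)) (clifford (2 * s - 1)) x y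

theorem tendsto_two_mul_atTop : Tendsto (fun N : ℕ => 2 * N) atTop atTop :=
  tendsto_id.const_mul_atTop' two_pos

theorem tendstoC1_laguerreFactor_left {s : ℝ} (hs : 0 < s) (y : ℝ) :
    TendstoC1 (fun N x => laguerreFactor s N x y) (fun x => besselFactor s x y) :=
  ((TendstoC1.const_seq ((tendsto_kernelConst hs).div_const 4)).mul
    ((tendstoC1_scaledLaguerre _ 0).symplecticForm_left
      (tendstoC1_scaledLaguerre _ 1) hs y)).comp_tendsto tendsto_two_mul_atTop

theorem tendstoC1_laguerreFactor_right {s : ℝ} (hs : 0 < s) (x : ℝ) :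
    TendstoC1 (fun N y => laguerreFactor s N x y) (fun y => besselFactor s x y) :=
  ((TendstoC1.const_seq ((tendsto_kernelConst hs).div_const 4)).mul
    ((tendstoC1_scaledLaguerre _ 0).symplecticForm_right
      (tendstoC1_scaledLaguerre _ 1) hs x)).comp_tendsto tendsto_two_mul_atTop

theorem tendsto_scaledS4 {s : ℝ} (hs : 0 < s) {x y : ℝ} (hx : 0 < x) (hy : 0 < y) :
    Tendsto (fun N : ℕ => scaledS4 s N x y) atTop (𝓝 (besselKernel s x y)) := by
  rw [besselKernel_eq hs hx hy]
  refine (((tendstoC1_laguerreFactor_left hs y).tendsto x).const_mul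
    (x ^ s * y ^ (s - 1))).congr' ?_
  filter_upwards [eventually_ne_atTop 0] with N hN
  exact (scaledS4_eq hs hN hx hy).symm

theorem pos_of_mem_uIcc {x y t : ℝ} (hx : 0 < x) (hy : 0 < y) (ht : t ∈ Set.uIcc x y) : 0 < t :=
  (lt_min hx hy).trans_le ht.1

theorem continuousOn_rpow_mul_rpow {s x y : ℝ} (hx : 0 < x) (hy : 0 < y) :
    ContinuousOn (fun t : ℝ => x ^ s * t ^ (s - 1)) (Set.uIcc y x) := fun _ ht =>
  (continuousAt_const.mul (Real.continuousAt_rpow_const _ _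
    (Or.inl (pos_of_mem_uIcc hy hx ht).ne'))).continuousWithinAt

theorem differentiableAt_rpow_mul_rpow {s x y : ℝ} (hx : 0 < x) :
    DifferentiableAt ℝ (fun u : ℝ => u ^ s * y ^ (s - 1)) x :=
  (Real.differentiableAt_rpow_const_of_ne s hx.ne').mul_const _

theorem besselKernel_eventuallyEq {s : ℝ} (hs : 0 < s) {x y : ℝ} (hx : 0 < x) (hy : 0 < y) :
    (fun u => besselKernel s u y) =ᶠ[𝓝 x] fun u => u ^ s * y ^ (s - 1) * besselFactor s u y := by
  filter_upwards [eventually_gt_nhds hx] with u hu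
  exact besselKernel_eq hs hu hy

theorem intervalIntegrable_besselKernel {s : ℝ} (hs : 0 < s) {x y : ℝ} (hx : 0 < x)
    (hy : 0 < y) : IntervalIntegrable (fun t => besselKernel s x t) volume y x := by
  refine ContinuousOn.intervalIntegrable (ContinuousOn.congr
    ((continuousOn_rpow_mul_rpow (s := s) hx hy).mul
      (tendstoC1_laguerreFactor_right hs x).differentiable_lim.continuous.continuousOn)
    fun t ht => ?_)
  exact besselKernel_eq hs hx (pos_of_mem_uIcc hy hx ht)

theorem tendsto_integral_scaledS4 {s : ℝ} (hs : 0 < s) {x y : ℝ} (hx : 0 < x) (hy : 0 < y) :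
    Tendsto (fun N : ℕ => ∫ t in y..x, scaledS4 s N x t) atTop
      (𝓝 (∫ t in y..x, besselKernel s x t)) := by
  rw [intervalIntegral.integral_congr fun t ht => besselKernel_eq hs hx (pos_of_mem_uIcc hy hx ht)]
  refine ((tendstoC1_laguerreFactor_right hs x).tendsto_integral_mul
    (continuousOn_rpow_mul_rpow (s := s) hx hy)).congr' ?_
  filter_upwards [eventually_ne_atTop 0] with N hN
  exact intervalIntegral.integral_congr fun t ht =>
    (scaledS4_eq hs hN hx (pos_of_mem_uIcc hy hx ht)).symm

theorem tendsto_deriv_scaledS4 {s : ℝ} (hs : 0 < s) {x y : ℝ} (hx : 0 < x) (hy : 0 < y) :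
    Tendsto (fun N : ℕ => deriv (fun u => scaledS4 s N u y) x) atTop
      (𝓝 (deriv (fun u => besselKernel s u y) x)) := by
  rw [(besselKernel_eventuallyEq hs hx hy).deriv_eq]
  refine ((tendstoC1_laguerreFactor_left hs y).tendsto_deriv_mul
    (differentiableAt_rpow_mul_rpow (s := s) (y := y) hx)).congr' ?_
  filter_upwards [eventually_ne_atTop 0] with N hN
  refine (EventuallyEq.deriv_eq ?_).symm
  filter_upwards [eventually_gt_nhds hx] with u hu
  exact scaledS4_eq hs hN hu hy

theorem hardEdgeKernel_eq {s : ℝ} (hs : 0 < s) {x y : ℝ} (hx : 0 < x) (hy : 0 < y) :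
    hardEdgeKernel s x y = besselKernel s x y :=
  (tendsto_scaledS4 hs hx hy).limUnder_eq

theorem hardEdgeKernel4_eq {s : ℝ} (hs : 0 < s) {x y : ℝ} (hx : 0 < x) (hy : 0 < y) :
    hardEdgeKernel4 s x y = besselKernel4 s x y := by
  have hint : ∫ t in y..x, hardEdgeKernel s x t = ∫ t in y..x, besselKernel s x t :=
    intervalIntegral.integral_congr fun t ht =>
      hardEdgeKernel_eq hs hx (pos_of_mem_uIcc hy hx ht)
  have hderiv : deriv (fun u => hardEdgeKernel s u y) x = deriv (fun u => besselKernel s u y) x := by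
    refine EventuallyEq.deriv_eq ?_
    filter_upwards [eventually_gt_nhds hx] with u hu
    exact hardEdgeKernel_eq hs hu hy
  rw [hardEdgeKernel4, besselKernel4, matrixKernel, matrixKernel, hardEdgeKernel_eq hs hx hy,
    hardEdgeKernel_eq hs hy hx, hint, hderiv]

theorem tendsto_matrixKernel_scaledS4 {s : ℝ} (hs : 0 < s) {x y : ℝ} (hx : 0 < x) (hy : 0 < y) :
    Tendsto (fun N : ℕ => matrixKernel (scaledS4 s N) x y) atTop (𝓝 (besselKernel4 s x y)) := by
  refine tendsto_pi_nhds.2 fun i => tendsto_pi_nhds.2 fun j => ?_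
  fin_cases i <;> fin_cases j
  · exact tendsto_scaledS4 hs hx hy
  · exact tendsto_integral_scaledS4 hs hx hy
  · exact tendsto_deriv_scaledS4 hs hx hy
  · exact tendsto_scaledS4 hs hy hx

end HardEdge

open HardEdge in
theorem proposition2p7 (s : ℝ) (hs : 0 < s) (x y : ℝ) (hx : 0 < x) (hy : 0 < y) :
    -- the scalar kernel of the scaling limit
    Tendsto (fun N : ℕ => scaledS4 s N x y) atTop (𝓝 (besselKernel s x y)) ∧
    hardEdgeKernel s x y = besselKernel s x y ∧
    -- the entries of the limiting matrix kernel make sense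
    IntervalIntegrable (fun t => besselJ (2 * s - 1) (2 * t)) volume 0 (√x) ∧
    IntervalIntegrable (fun t => besselKernel s x t) volume y x ∧
    DifferentiableAt ℝ (fun u => besselKernel s u y) x ∧
    -- the matrix kernel of the scaling limit
    hardEdgeKernel4 s x y = besselKernel4 s x y ∧
    Tendsto (fun N : ℕ => matrixKernel (scaledS4 s N) x y) atTop (𝓝 (besselKernel4 s x y)) ∧
    -- agreement with the other known form of the limit kernel
    besselKernel s x y =
      2 * besselKernel2 (2 * s) (4 * x) (4 * y) -
        besselJ (2 * s - 1) (2 * √y) / (2 * √y) *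
          ∫ t in (0 : ℝ)..√x, besselJ (2 * s + 1) (2 * t) := by
  have hν : -1 < 2 * s - 1 := by linarith
  refine ⟨tendsto_scaledS4 hs hx hy, hardEdgeKernel_eq hs hx hy,
    intervalIntegrable_besselJ hν (Real.sqrt_nonneg x), intervalIntegrable_besselKernel hs hx hy,
    ?_, hardEdgeKernel4_eq hs hx hy, tendsto_matrixKernel_scaledS4 hs hx hy, ?_⟩
  · exact (besselKernel_eventuallyEq hs hx hy).differentiableAt_iff.2
      ((differentiableAt_rpow_mul_rpow hx).mul
        ((tendstoC1_laguerreFactor_left hs y).differentiable_lim x))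
  · have h1 := besselKernel2_shift (ν := 2 * s - 1) hx hy
    have h2 := integral_besselJ_sub hν (Real.sqrt_pos.2 hx)
    rw [sub_add_cancel] at h1 h2
    rw [show 2 * s - 1 + 2 = 2 * s + 1 by ring] at h2
    rw [besselKernel, h1]
    linear_combination (-(besselJ (2 * s - 1) (2 * √y) / (2 * √y))) * h2
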